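/- **Setting.** Let $\Omega=(l_1,l_2)\times(l_3,l_4)$, let $\psi$ be continuous on $\Omega$, and put $\Gamma_I=\{\psi=0\}$, $\Omega^+=\{\psi>0\}$, $\Omega^-=\{\psi<0\}$ (subsets of $\Omega$). Let $a>0$ be of class $C^6$ in each of $\Omega^\pm$. Fix $p=(x^*,y^*)\in\Omega\setminus\Gamma_I$ and write $g^{(m,n)}=\partial_x^m\partial_y^n g(p)$. For $h>0$ the compact stencil centered at $p$ consists of the nine points $p+(kh,\ell h)$, $k,\ell\in\{-1,0,1\}$; $p$ is a *regular point* (for $h$) if $\psi\ge 0$ at all nine points or $\psi<0$ at all nine points. Let $\Lambda_K=\{(m,n)\in\mathbb N_0^2: m+n\le K\}$, $\Lambda^{V,1}_K=\{(m,n)\in\Lambda_K: m\le 1\}$, $\Lambda^{V,2}_K=\Lambda_K\setminus\Lambda^{V,1}_K$. Applying $\partial_x^{m}\partial_y^{n}$ to $a(u_{xx}+u_{yy})+a_xu_x+a_yu_y=-f$ at $p$ and solving for $u^{(m+2,n)}$ expresses recursively each $u^{(m',n')}$ with $m'\ge2$ as a linear combination of the $u^{(m,n)}$ with $m\le1$ and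 the $f^{(m,n)}$; let $A^{V,u}_{m',n',m,n}$ and $A^{V,f}_{m',n',m,n}$ be the coefficients of $u^{(m,n)}$ and of $f^{(m,n)}$ in it. With $M=6$ put $$G_{m,n}(x,y)=\sum_{\ell=0}^{\lfloor n/2\rfloor}\frac{(-1)^\ell x^{m+2\ell}y^{n-2\ell}}{(m+2\ell)!\,(n-2\ell)!}+\sum_{(m',n')\in\Lambda^{V,2}_{M+1}\setminus\Lambda^{V,2}_{m+n}}A^{V,u}_{m',n',m,n}\frac{x^{m'}y^{n'}}{m'!\,n'!},\qquad (m,n)\in\Lambda^{V,1}_{M+1},$$ $$Q_{m,n}(x,y)=\sum_{\ell=1}^{1+\lfloor n/2\rfloor}\frac{(-1)^\ell x^{m+2\ell}y^{n-2\ell+2}}{(m+2\ell)!\,(n-2\ell+2)!}\frac1{a^{(0,0)}}+\sum_{(m',n')\in\Lambda^{V,2}_{M+1}\setminus\Lambda^{V,2}_{m+n+2}}A^{V,f}_{m',n',m,n}\frac{x^{m'}y^{n'}}{m'!\,n'!},\qquad (m,n)\in\Lambda_{M-1}.$$ For real numbers $c_{k,\ell,i}$ let $C_{k,\ell}(h)=\sum_{i=0}^{7}c_{k,\ell,i}h^i$.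 The *order-matching linear system* for $\{c_{k,\ell,i}\}$ is $$\sum_{k=-1}^1\sum_{\ell=-1}^1 C_{k,\ell}(h)\,G_{m,n}(kh,\ell h)=\mathcal O(h^{8})\quad(h\to0^+)\qquad\text{for all }(m,n)\in\Lambda^{V,1}_{7},$$ and a solution is *nontrivial* if $C_{k,\ell}(0)\ne0$ for some $k,\ell$. Put $C_{f,m,n}(h)=\sum_{k,\ell}C_{k,\ell}(h)Q_{m,n}(kh,\ell h)$. **Theorem 2.1.** For all sufficiently small $h>0$ the stencil centered at $p$ lies in $\Omega$ and $p$ is a regular point. Moreover: 1. The order-matching system has a nontrivial solution. 2. For every nontrivial solution, the scheme $\mathcal L_hu_h:=\sum_{k,\ell}C_{k,\ell}(h)\,u_h(p+(kh,\ell h))=\sum_{(m,n)\in\Lambda_5}f^{(m,n)}C_{f,m,n}(h)$ is sixth-order consistent with $-\nabla\cdot(a\nabla u)=f$ at $p$: there is $\lambda\neq0$ such that for all $u,f$ with $u\in C^7(\Omega^\pm)$ with locally Lipschitz derivatives of order seven in $\Omega^\pm$ and $-\nabla\cdot(a\nabla u)=f$ in $\Omega\setminus\Gamma_I$, one has, as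 $h\to0^+$, $$h^{-2}\mathcal L_hu\to\lambda f(p)\qquad\text{and}\qquad \mathcal L_hu-\sum_{(m,n)\in\Lambda_5}f^{(m,n)}C_{f,m,n}(h)=\mathcal O(h^{8}).$$ 3. Six is the maximum accuracy order of a compact nine-point scheme at $p$. Here a scheme is $\sum_{k,\ell}C_{k,\ell}(h)u_h(p+(kh,\ell h))=\sum_{(m,n)\in\Lambda_N}f^{(m,n)}F_{m,n}(h)$ with some $N\ge0$ such that $a$ is $C^{N+1}$ near $p$, and arbitrary functions $C_{k,\ell},F_{m,n}$ of $h$ such that not all $C_{k,\ell}(h)$ tend to $0$ as $h\to0^+$; it has accuracy order $q\in\mathbb N_0$ if, for every $u\in C^\infty(\mathbb R^2)$ and $f=-\nabla\cdot(a\nabla u)$, the difference of its two sides with $u_h=u$ is $\mathcal O(h^{q+2})$ as $h\to0^+$. The largest $q$ for which a scheme of accuracy order $q$ exists is $6$. -/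

import Mathlib

open Set Filter Topology
open scoped ContDiff BigOperators

noncomputable section

namespace CompactFD

/-! ### Partial derivatives and the elliptic operator -/

/-- The partial derivative `∂g/∂x`. -/
def dx (g : ℝ × ℝ → ℝ) : ℝ × ℝ → ℝ :=
  fun q => deriv (fun s => g (s, q.2)) q.1

/-- The partial derivative `∂g/∂y`. -/
def dy (g : ℝ × ℝ → ℝ) : ℝ × ℝ → ℝ :=
  fun q => deriv (fun t => g (q.1, t)) q.2

/-- The partial derivative `g^{(m,n)} = ∂^{m+n} g / ∂x^m ∂y^n`, as a function. -/
def pderiv (m n : ℕ) (g : ℝ × ℝ → ℝ) : ℝ × ℝ → ℝ :=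
  dx^[m] (dy^[n] g)

/-- The elliptic operator `-∇·(a∇u)`. -/
def ellip (a u : ℝ × ℝ → ℝ) : ℝ × ℝ → ℝ :=
  fun q => -(dx (fun z => a z * dx u z) q + dy (fun z => a z * dy u z) q)

/-! ### The domain, the interface and regular points -/

/-- `Ω = (l₁, l₂) × (l₃, l₄)`. -/
def rect (l₁ l₂ l₃ l₄ : ℝ) : Set (ℝ × ℝ) := Ioo l₁ l₂ ×ˢ Ioo l₃ l₄

/-- `Ω⁺ = {ψ > 0}`. -/
def omegaPlus (Ω : Set (ℝ × ℝ)) (ψ : ℝ × ℝ → ℝ) : Set (ℝ × ℝ) := {q ∈ Ω | 0 < ψ q}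

/-- `Ω⁻ = {ψ < 0}`. -/
def omegaMinus (Ω : Set (ℝ × ℝ)) (ψ : ℝ × ℝ → ℝ) : Set (ℝ × ℝ) := {q ∈ Ω | ψ q < 0}

/-- The interface `Γ_I = {ψ = 0}`. -/
def interface (Ω : Set (ℝ × ℝ)) (ψ : ℝ × ℝ → ℝ) : Set (ℝ × ℝ) := {q ∈ Ω | ψ q = 0}

/-- The stencil indices `{-1, 0, 1}`. -/
def stIdx : Finset ℤ := Finset.Icc (-1) 1

/-- The stencil point `p + (k h, ℓ h)`. -/
def stPt (p : ℝ × ℝ) (h : ℝ) (k l : ℤ) : ℝ × ℝ := (p.1 + k * h, p.2 + l * h)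

/-- `d⁺`: the stencil indices whose points satisfy `ψ ≥ 0`. -/
def dPlus (ψ : ℝ × ℝ → ℝ) (p : ℝ × ℝ) (h : ℝ) : Set (ℤ × ℤ) :=
  {κ | κ.1 ∈ stIdx ∧ κ.2 ∈ stIdx ∧ 0 ≤ ψ (stPt p h κ.1 κ.2)}

/-- `d⁻`: the stencil indices whose points satisfy `ψ < 0`. -/
def dMinus (ψ : ℝ × ℝ → ℝ) (p : ℝ × ℝ) (h : ℝ) : Set (ℤ × ℤ) :=
  {κ | κ.1 ∈ stIdx ∧ κ.2 ∈ stIdx ∧ ψ (stPt p h κ.1 κ.2) < 0}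

/-- The centre `p` of the stencil of mesh size `h` is a regular point:
`d⁺ = ∅` or `d⁻ = ∅`. -/
def IsRegularPoint (ψ : ℝ × ℝ → ℝ) (p : ℝ × ℝ) (h : ℝ) : Prop :=
  dPlus ψ p h = ∅ ∨ dMinus ψ p h = ∅

/-- The coefficient `a` is positive and of class `C⁶` in each of the subregions. -/
structure IsCoefficient (Ω : Set (ℝ × ℝ)) (ψ a : ℝ × ℝ → ℝ) : Prop where
  pos_plus : ∀ q ∈ omegaPlus Ω ψ, 0 < a q
  pos_minus : ∀ q ∈ omegaMinus Ω ψ, 0 < a q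
  smooth_plus : ContDiffOn ℝ 6 a (omegaPlus Ω ψ)
  smooth_minus : ContDiffOn ℝ 6 a (omegaMinus Ω ψ)

/-- `u` is of class `C⁷` with locally Lipschitz derivatives of order seven in each of the
subregions, and `-∇·(a∇u) = f` in `Ω \ Γ_I`. Nothing is asked on the interface or on
the boundary of `Ω`. -/
structure IsSolution (Ω : Set (ℝ × ℝ)) (ψ a u f : ℝ × ℝ → ℝ) : Prop where
  smooth_plus : ContDiffOn ℝ 7 u (omegaPlus Ω ψ)
  smooth_minus : ContDiffOn ℝ 7 u (omegaMinus Ω ψ)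
  lip_plus : ∀ m n, m + n = 7 → LocallyLipschitzOn (omegaPlus Ω ψ) (pderiv m n u)
  lip_minus : ∀ m n, m + n = 7 → LocallyLipschitzOn (omegaMinus Ω ψ) (pderiv m n u)
  pde : ∀ q ∈ Ω \ interface Ω ψ, ellip a u q = f q

/-! ### Index sets -/

/-- `Λ_K = {(m, n) : m + n ≤ K}`. -/
def Lam (K : ℕ) : Finset (ℕ × ℕ) :=
  (Finset.range (K + 1) ×ˢ Finset.range (K + 1)).filter fun μ => μ.1 + μ.2 ≤ K

/-- `Λ_K^{V,1}`: the elements `(m, n)` of `Λ_K` with `m ∈ {0, 1}`. -/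
def LamV1 (K : ℕ) : Finset (ℕ × ℕ) := (Lam K).filter fun μ => μ.1 ≤ 1

/-- `Λ_K^{V,2} = Λ_K \ Λ_K^{V,1}`. -/
def LamV2 (K : ℕ) : Finset (ℕ × ℕ) := Lam K \ LamV1 K

/-! ### The constants `A^{V,u}`, `A^{V,f}` and the functions `G^V`, `Q^V`

At the base point write `α i j = a^{(i,j)}`. Applying `∂_x^m ∂_y^n` to
`a (u_xx + u_yy) + a_x u_x + a_y u_y = -f` and solving for the term `a^{(0,0)} u^{(m+2,n)}`
gives a recursion that determines every `u^{(m,n)}` from the `u^{(0,n)}`, the `u^{(1,n)}` and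
the `f^{(m,n)}`. -/

/-- The values `u^{(m,n)}` determined by `u^{(m,n)} = v m n` for `m ∈ {0, 1}`, by
`f^{(m,n)} = φ m n`, and by the differentiated equation. -/
def solJet (α v φ : ℕ → ℕ → ℝ) : ℕ → ℕ → ℝ
  | 0, n => v 0 n
  | 1, n => v 1 n
  | m + 2, n =>
    -(α 0 0)⁻¹ * (φ m n + α 0 0 * solJet α v φ m (n + 2)
      + ∑ i : Fin (m + 1), ∑ j : Fin (n + 1), (m.choose i : ℝ) * (n.choose j : ℝ) *
          (if _hij : (i : ℕ) + (j : ℕ) = 0 then 0 else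
            α i j * (solJet α v φ (m + 2 - i) (n - j) + solJet α v φ (m - i) (n + 2 - j)))
      + ∑ i : Fin (m + 1), ∑ j : Fin (n + 1), (m.choose i : ℝ) * (n.choose j : ℝ) *
          (α (i + 1) j * solJet α v φ (m + 1 - i) (n - j)
            + α i (j + 1) * solJet α v φ (m - i) (n + 1 - j)))
termination_by m n => (m + n, m)
decreasing_by all_goals (simp only [Prod.lex_def]; omega)

/-- The array with entry `1` at `(m, n)` and `0` elsewhere. -/
def unitJet (m n : ℕ) : ℕ → ℕ → ℝ := fun i j => if i = m ∧ j = n then 1 else 0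

/-- `A^{V,u}_{m',n',m,n}`: the coefficient of `u^{(m,n)}` in `u^{(m',n')}`. -/
def AVu (α : ℕ → ℕ → ℝ) (m' n' m n : ℕ) : ℝ := solJet α (unitJet m n) 0 m' n'

/-- `A^{V,f}_{m',n',m,n}`: the coefficient of `f^{(m,n)}` in `u^{(m',n')}`. -/
def AVf (α : ℕ → ℕ → ℝ) (m' n' m n : ℕ) : ℝ := solJet α 0 (unitJet m n) m' n'

/-- `G^V_{M,m,n}(x,y)`, for `(m, n) ∈ Λ_{M+1}^{V,1}`. -/
def GV (α : ℕ → ℕ → ℝ) (M m n : ℕ) (x y : ℝ) : ℝ :=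
  ∑ l ∈ Finset.range (n / 2 + 1),
      (-1) ^ l * x ^ (m + 2 * l) * y ^ (n - 2 * l)
        / ((m + 2 * l).factorial * (n - 2 * l).factorial)
    + ∑ μ ∈ LamV2 (M + 1) \ LamV2 (m + n),
      AVu α μ.1 μ.2 m n * (x ^ μ.1 * y ^ μ.2 / (μ.1.factorial * μ.2.factorial))

/-- `Q^V_{M,m,n}(x,y)`, for `(m, n) ∈ Λ_{M-1}`. -/
def QV (α : ℕ → ℕ → ℝ) (M m n : ℕ) (x y : ℝ) : ℝ :=
  ∑ l ∈ Finset.Icc 1 (1 + n / 2),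
      (-1) ^ l * x ^ (m + 2 * l) * y ^ (n + 2 - 2 * l)
        / ((m + 2 * l).factorial * (n + 2 - 2 * l).factorial) * (1 / α 0 0)
    + ∑ μ ∈ LamV2 (M + 1) \ LamV2 (m + n + 2),
      AVf α μ.1 μ.2 m n * (x ^ μ.1 * y ^ μ.2 / (μ.1.factorial * μ.2.factorial))

/-- The derivatives `a^{(i,j)}` at the base point `p`. -/
def jetAt (a : ℝ × ℝ → ℝ) (p : ℝ × ℝ) : ℕ → ℕ → ℝ := fun i j => pderiv i j a p

/-! ### Compact nine-point schemes -/

/-- `C_{k,ℓ}(h) = ∑_{i=0}^{M+1} c_{k,ℓ,i} h^i`. -/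
def polyCoeff (M : ℕ) (c : ℤ → ℤ → ℕ → ℝ) (k l : ℤ) (h : ℝ) : ℝ :=
  ∑ i ∈ Finset.range (M + 2), c k l i * h ^ i

/-- The order-matching linear system for `c`:
`∑_{k,ℓ} C_{k,ℓ}(h) G^V_{M,m,n}(kh, ℓh) = O(h^{M+2})` for all `(m,n) ∈ Λ_{M+1}^{V,1}`. -/
def SolvesSystem (α : ℕ → ℕ → ℝ) (M : ℕ) (c : ℤ → ℤ → ℕ → ℝ) : Prop :=
  ∀ μ ∈ LamV1 (M + 1),
    (fun h : ℝ => ∑ k ∈ stIdx, ∑ l ∈ stIdx,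
      polyCoeff M c k l h * GV α M μ.1 μ.2 (k * h) (l * h)) =O[𝓝[>] 0] fun h => h ^ (M + 2)

/-- Nontriviality of `c`: some `C_{k,ℓ}(0) = c_{k,ℓ,0}` is nonzero. -/
def Nontriv (c : ℤ → ℤ → ℕ → ℝ) : Prop := ∃ k ∈ stIdx, ∃ l ∈ stIdx, c k l 0 ≠ 0

/-- `C_{f,m,n}(h) = ∑_{k,ℓ} C_{k,ℓ}(h) Q^V_{M,m,n}(kh, ℓh)`. -/
def rhsCoeff (α : ℕ → ℕ → ℝ) (M : ℕ) (c : ℤ → ℤ → ℕ → ℝ) (m n : ℕ) (h : ℝ) : ℝ :=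
  ∑ k ∈ stIdx, ∑ l ∈ stIdx, polyCoeff M c k l h * QV α M m n (k * h) (l * h)

/-- The nine-point operator `L_h u = ∑_{k,ℓ} C_{k,ℓ}(h) u(p + (kh, ℓh))`. -/
def stencilOp (C : ℤ → ℤ → ℝ → ℝ) (p : ℝ × ℝ) (u : ℝ × ℝ → ℝ) (h : ℝ) : ℝ :=
  ∑ k ∈ stIdx, ∑ l ∈ stIdx, C k l h * u (stPt p h k l)

/-- The truncation error `L_h u - ∑_{(m,n) ∈ Λ_N} f^{(m,n)} F_{m,n}(h)`, the derivatives of `f`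
being taken at the centre `p`. -/
def truncError (N : ℕ) (C : ℤ → ℤ → ℝ → ℝ) (F : ℕ → ℕ → ℝ → ℝ) (p : ℝ × ℝ)
    (u f : ℝ × ℝ → ℝ) (h : ℝ) : ℝ :=
  stencilOp C p u h - ∑ μ ∈ Lam N, pderiv μ.1 μ.2 f p * F μ.1 μ.2 h

/-- The compact scheme `∑_{k,ℓ} C_{k,ℓ}(h) u(p + (kh, ℓh)) = ∑_{(m,n) ∈ Λ_N} f^{(m,n)} F_{m,n}(h)`,
with arbitrary functions `C_{k,ℓ}`, `F_{m,n}` of `h`, is nontrivial (the `C_{k,ℓ}(h)` do not all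
tend to `0` as `h → 0+`) and has accuracy order `q` at `p` for `-∇·(a∇u) = f`: for
smooth `u` and `f = -∇·(a∇u)` its truncation error is `O(h^{q+2})`. -/
def HasAccuracyOrder (a : ℝ × ℝ → ℝ) (p : ℝ × ℝ) (N : ℕ) (C : ℤ → ℤ → ℝ → ℝ)
    (F : ℕ → ℕ → ℝ → ℝ) (q : ℕ) : Prop :=
  (¬ ∀ k ∈ stIdx, ∀ l ∈ stIdx, Tendsto (C k l) (𝓝[>] 0) (𝓝 0)) ∧
  ∀ u : ℝ × ℝ → ℝ, ContDiff ℝ ∞ u →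
    truncError N C F p u (ellip a u) =O[𝓝[>] 0] fun h : ℝ => h ^ (q + 2)

end CompactFD

end

open CompactFD

namespace CompactFD

/-! ### Calculus of the partial derivatives -/

/-! Everything takes place on the level of jets at `p`. By the Leibniz rule (`pderiv_ellip`) the
differentiated equation is a triangular system for the derivatives of `u`, with principal part
`a(p)` times the Laplacian. It has one solution for each choice of the `u^{(m,n)}` with `m ≤ 1` and
of the derivatives of `f` (`divGradJet_solJet`, `jet_unique`). Hence `G_{m,n}` and `Q_{m,n}` are
Taylor polynomials of basic solution jets (`GV_eq_taylorPoly`, `QV_eq_taylorPoly`), and the Taylor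
polynomial of any solution is their combination (`taylorPoly_eq_sum`).

Consistency: by that identity, the truncation error is a weighted sum of Taylor remainders plus a
combination of the left-hand sides of the order-matching system, so it is `O(h⁸)`
(`isBigO_truncError`). The leading part of `G_{m,n}` is a harmonic polynomial of degree `m + n`, so
the weights `C_{k,ℓ}(0)` annihilate harmonic polynomials. Those of degree at most 4 together with
`x²` separate the weights on nine points, whence `λ ≠ 0` (`leadRhs_ne_zero`).

Existence: with `a` replaced by a polynomial of the same jet and `w = √a`, the substitution `v = wu`
turns `∇·(a∇u) = 0` into `Δv = qv`, `q = Δw/w`. For this equation the classical nine-point Laplacian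
can be corrected explicitly to a compact sixth-order scheme (`schrodingerForm_eq`). Its weights
times `w(kh, ℓh)`, truncated to degree 7 in `h`, solve the system (`exists_nontriv_solvesSystem`).

Optimality: on the nine points the harmonic polynomials of degree at most 7 leave one weight
undetermined, and degree 8 removes this freedom. Testing a scheme of order at least 7 on polynomials
whose jets solve the homogeneous equation therefore forces all its coefficients to `0`
(`order_le_six`). -/

theorem dx_congr {f g : ℝ × ℝ → ℝ} {p : ℝ × ℝ} (h : f =ᶠ[𝓝 p] g) : dx f =ᶠ[𝓝 p] dx g := by
  filter_upwards [h.eventuallyEq_nhds] with q hq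
  have hc : Tendsto (fun s : ℝ => (s, q.2)) (𝓝 q.1) (𝓝 q) :=
    Continuous.tendsto' (by fun_prop) _ _ rfl
  exact Filter.EventuallyEq.deriv_eq (hc.eventually hq)

theorem dy_congr {f g : ℝ × ℝ → ℝ} {p : ℝ × ℝ} (h : f =ᶠ[𝓝 p] g) : dy f =ᶠ[𝓝 p] dy g := by
  filter_upwards [h.eventuallyEq_nhds] with q hq
  have hc : Tendsto (fun s : ℝ => (q.1, s)) (𝓝 q.2) (𝓝 q) :=
    Continuous.tendsto' (by fun_prop) _ _ rfl
  exact Filter.EventuallyEq.deriv_eq (hc.eventually hq)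

theorem iterate_dx_congr (m : ℕ) {f g : ℝ × ℝ → ℝ} {p : ℝ × ℝ} (h : f =ᶠ[𝓝 p] g) :
    dx^[m] f =ᶠ[𝓝 p] dx^[m] g := by
  induction m generalizing f g with
  | zero => simpa using h
  | succ m ih => simpa using ih (dx_congr h)

theorem iterate_dy_congr (m : ℕ) {f g : ℝ × ℝ → ℝ} {p : ℝ × ℝ} (h : f =ᶠ[𝓝 p] g) :
    dy^[m] f =ᶠ[𝓝 p] dy^[m] g := by
  induction m generalizing f g with
  | zero => simpa using h
  | succ m ih => simpa using ih (dy_congr h)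

theorem pderiv_congr (m n : ℕ) {f g : ℝ × ℝ → ℝ} {p : ℝ × ℝ} (h : f =ᶠ[𝓝 p] g) :
    pderiv m n f =ᶠ[𝓝 p] pderiv m n g :=
  iterate_dx_congr m (iterate_dy_congr n h)

theorem ellip_congr {a b u v : ℝ × ℝ → ℝ} {p : ℝ × ℝ} (hab : a =ᶠ[𝓝 p] b)
    (huv : u =ᶠ[𝓝 p] v) : ellip a u =ᶠ[𝓝 p] ellip b v := by
  have h1 : (fun z => a z * dx u z) =ᶠ[𝓝 p] fun z => b z * dx v z := hab.mul (dx_congr huv)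
  have h2 : (fun z => a z * dy u z) =ᶠ[𝓝 p] fun z => b z * dy v z := hab.mul (dy_congr huv)
  exact ((dx_congr h1).add (dy_congr h2)).neg

theorem hasDerivAt_fst {g : ℝ × ℝ → ℝ} {q : ℝ × ℝ} (h : DifferentiableAt ℝ g q) :
    HasDerivAt (fun s => g (s, q.2)) (fderiv ℝ g q (1, 0)) q.1 := by
  have h1 : HasDerivAt (fun s : ℝ => (s, q.2)) ((1 : ℝ), (0 : ℝ)) q.1 :=
    (hasDerivAt_id q.1).prodMk (hasDerivAt_const q.1 q.2)
  exact HasFDerivAt.comp_hasDerivAt q.1 (f := fun s : ℝ => (s, q.2)) h.hasFDerivAt h1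

theorem hasDerivAt_snd {g : ℝ × ℝ → ℝ} {q : ℝ × ℝ} (h : DifferentiableAt ℝ g q) :
    HasDerivAt (fun s => g (q.1, s)) (fderiv ℝ g q (0, 1)) q.2 := by
  have h1 : HasDerivAt (fun s : ℝ => (q.1, s)) ((0 : ℝ), (1 : ℝ)) q.2 :=
    (hasDerivAt_const q.2 q.1).prodMk (hasDerivAt_id q.2)
  exact HasFDerivAt.comp_hasDerivAt q.2 (f := fun s : ℝ => (q.1, s)) h.hasFDerivAt h1

theorem dx_eq_fderiv {g : ℝ × ℝ → ℝ} {q : ℝ × ℝ} (h : DifferentiableAt ℝ g q) :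
    dx g q = fderiv ℝ g q (1, 0) := (hasDerivAt_fst h).deriv

theorem dy_eq_fderiv {g : ℝ × ℝ → ℝ} {q : ℝ × ℝ} (h : DifferentiableAt ℝ g q) :
    dy g q = fderiv ℝ g q (0, 1) := (hasDerivAt_snd h).deriv

theorem eventually_differentiableAt {g : ℝ × ℝ → ℝ} {p : ℝ × ℝ} {n : ℕ}
    (h : ContDiffAt ℝ (n + 1 : ℕ) g p) : ∀ᶠ q in 𝓝 p, DifferentiableAt ℝ g q := by
  filter_upwards [h.eventually (by simp)] with q hq
  exact hq.differentiableAt (by simp)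

theorem dx_eventuallyEq_fderiv {g : ℝ × ℝ → ℝ} {p : ℝ × ℝ} {n : ℕ}
    (h : ContDiffAt ℝ (n + 1 : ℕ) g p) : dx g =ᶠ[𝓝 p] fun q => fderiv ℝ g q (1, 0) := by
  filter_upwards [eventually_differentiableAt h] with q hq using dx_eq_fderiv hq

theorem dy_eventuallyEq_fderiv {g : ℝ × ℝ → ℝ} {p : ℝ × ℝ} {n : ℕ}
    (h : ContDiffAt ℝ (n + 1 : ℕ) g p) : dy g =ᶠ[𝓝 p] fun q => fderiv ℝ g q (0, 1) := by
  filter_upwards [eventually_differentiableAt h] with q hq using dy_eq_fderiv hq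

theorem contDiffAt_fderiv_apply {g : ℝ × ℝ → ℝ} {p : ℝ × ℝ} {n : ℕ} (v : ℝ × ℝ)
    (h : ContDiffAt ℝ (n + 1 : ℕ) g p) : ContDiffAt ℝ n (fun q => fderiv ℝ g q v) p :=
  (h.fderiv_right (m := n) (by norm_cast)).clm_apply contDiffAt_const

theorem contDiffAt_dx {g : ℝ × ℝ → ℝ} {p : ℝ × ℝ} {n : ℕ}
    (h : ContDiffAt ℝ (n + 1 : ℕ) g p) : ContDiffAt ℝ n (dx g) p :=
  (contDiffAt_fderiv_apply _ h).congr_of_eventuallyEq (dx_eventuallyEq_fderiv h)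

theorem contDiffAt_dy {g : ℝ × ℝ → ℝ} {p : ℝ × ℝ} {n : ℕ}
    (h : ContDiffAt ℝ (n + 1 : ℕ) g p) : ContDiffAt ℝ n (dy g) p :=
  (contDiffAt_fderiv_apply _ h).congr_of_eventuallyEq (dy_eventuallyEq_fderiv h)

theorem _root_.ContDiffAt.of_nat_le {g : ℝ × ℝ → ℝ} {p : ℝ × ℝ} {m n : ℕ}
    (h : ContDiffAt ℝ n g p) (hmn : m ≤ n) : ContDiffAt ℝ m g p :=
  h.of_le (by exact_mod_cast hmn)

theorem contDiffAt_iterate_dx (m : ℕ) {g : ℝ × ℝ → ℝ} {p : ℝ × ℝ} {n : ℕ}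
    (h : ContDiffAt ℝ (n + m : ℕ) g p) : ContDiffAt ℝ n (dx^[m] g) p := by
  induction m generalizing g with
  | zero => simpa using h
  | succ m ih => exact ih (contDiffAt_dx h)

theorem contDiffAt_iterate_dy (m : ℕ) {g : ℝ × ℝ → ℝ} {p : ℝ × ℝ} {n : ℕ}
    (h : ContDiffAt ℝ (n + m : ℕ) g p) : ContDiffAt ℝ n (dy^[m] g) p := by
  induction m generalizing g with
  | zero => simpa using h
  | succ m ih => exact ih (contDiffAt_dy h)

theorem contDiffAt_pderiv (i j : ℕ) {g : ℝ × ℝ → ℝ} {p : ℝ × ℝ} {n : ℕ}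
    (h : ContDiffAt ℝ (n + i + j : ℕ) g p) : ContDiffAt ℝ n (pderiv i j g) p :=
  contDiffAt_iterate_dx i (contDiffAt_iterate_dy j h)

theorem dx_dy_comm {g : ℝ × ℝ → ℝ} {p : ℝ × ℝ} (h : ContDiffAt ℝ (2 : ℕ) g p) :
    dy (dx g) =ᶠ[𝓝 p] dx (dy g) := by
  have key : ∀ q, ContDiffAt ℝ (2 : ℕ) g q → dy (dx g) q = dx (dy g) q := by
    intro q hq
    have hq' : ContDiffAt ℝ (1 + 1 : ℕ) g q := hq
    rw [(dy_congr (dx_eventuallyEq_fderiv hq')).eq_of_nhds,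
      (dx_congr (dy_eventuallyEq_fderiv hq')).eq_of_nhds,
      dx_eq_fderiv ((contDiffAt_fderiv_apply _ hq').differentiableAt (by simp)),
      dy_eq_fderiv ((contDiffAt_fderiv_apply _ hq').differentiableAt (by simp))]
    have hd : DifferentiableAt ℝ (fderiv ℝ g) q :=
      (hq'.fderiv_right (m := 1) (by norm_cast)).differentiableAt (by simp)
    have e : ∀ v w : ℝ × ℝ, fderiv ℝ (fun q => fderiv ℝ g q v) q w
        = fderiv ℝ (fderiv ℝ g) q w v := by
      intro v w
      have h2 := (hd.hasFDerivAt.clm_apply (hasFDerivAt_const v q)).fderiv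
      rw [h2]; simp
    rw [e, e]
    exact (hq.isSymmSndFDerivAt (by simp)).eq _ _
  filter_upwards [h.eventually (by simp)] with q hq using key q hq

theorem iterate_dy_dx_comm (n : ℕ) {g : ℝ × ℝ → ℝ} {p : ℝ × ℝ}
    (h : ContDiffAt ℝ (n + 1 : ℕ) g p) : dy^[n] (dx g) =ᶠ[𝓝 p] dx (dy^[n] g) := by
  induction n generalizing g with
  | zero => rfl
  | succ n ih =>
    have h2 : ContDiffAt ℝ (2 : ℕ) g p := h.of_nat_le (by omega)
    exact (iterate_dy_congr n (dx_dy_comm h2)).trans (ih (contDiffAt_dy h))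

theorem pderiv_dx (m n : ℕ) {g : ℝ × ℝ → ℝ} {p : ℝ × ℝ}
    (h : ContDiffAt ℝ (n + 1 : ℕ) g p) : pderiv m n (dx g) =ᶠ[𝓝 p] pderiv (m + 1) n g :=
  iterate_dx_congr m (iterate_dy_dx_comm n h)

theorem pderiv_dy (m n : ℕ) (g : ℝ × ℝ → ℝ) : pderiv m n (dy g) = pderiv m (n + 1) g := rfl

theorem iterate_dx_apply (n : ℕ) (g : ℝ × ℝ → ℝ) (q : ℝ × ℝ) :
    dx^[n] g q = iteratedDeriv n (fun s => g (s, q.2)) q.1 := by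
  induction n generalizing q with
  | zero => simp
  | succ n ih =>
    rw [Function.iterate_succ_apply', iteratedDeriv_succ]
    simp only [dx, ih]

theorem iterate_dy_apply (n : ℕ) (g : ℝ × ℝ → ℝ) (q : ℝ × ℝ) :
    dy^[n] g q = iteratedDeriv n (fun s => g (q.1, s)) q.2 := by
  induction n generalizing q with
  | zero => simp
  | succ n ih =>
    rw [Function.iterate_succ_apply', iteratedDeriv_succ]
    simp only [dy, ih]

theorem contDiffAt_fst_slice {g : ℝ × ℝ → ℝ} {q : ℝ × ℝ} {n : ℕ} (h : ContDiffAt ℝ n g q) :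
    ContDiffAt ℝ n (fun s => g (s, q.2)) q.1 :=
  ContDiffAt.comp (f := fun s : ℝ => (s, q.2)) q.1 h (by fun_prop)

theorem contDiffAt_snd_slice {g : ℝ × ℝ → ℝ} {q : ℝ × ℝ} {n : ℕ} (h : ContDiffAt ℝ n g q) :
    ContDiffAt ℝ n (fun s => g (q.1, s)) q.2 :=
  ContDiffAt.comp (f := fun s : ℝ => (q.1, s)) q.2 h (by fun_prop)

theorem pderiv_add (m n : ℕ) {f g : ℝ × ℝ → ℝ} {p : ℝ × ℝ} (hf : ContDiffAt ℝ (m + n : ℕ) f p)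
    (hg : ContDiffAt ℝ (m + n : ℕ) g p) :
    pderiv m n (fun q => f q + g q) p = pderiv m n f p + pderiv m n g p := by
  have h1 : dy^[n] (fun q => f q + g q) =ᶠ[𝓝 p] fun q => dy^[n] f q + dy^[n] g q := by
    filter_upwards [(hf.of_nat_le (show n ≤ m + n by omega)).eventually (by simp),
      (hg.of_nat_le (show n ≤ m + n by omega)).eventually (by simp)] with q h1 h2
    simp only [iterate_dy_apply]
    exact iteratedDeriv_fun_add (contDiffAt_snd_slice h1) (contDiffAt_snd_slice h2)
  rw [pderiv, (iterate_dx_congr m h1).eq_of_nhds]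
  simp only [pderiv, iterate_dx_apply]
  exact iteratedDeriv_fun_add (contDiffAt_fst_slice (contDiffAt_iterate_dy n hf))
    (contDiffAt_fst_slice (contDiffAt_iterate_dy n hg))

theorem pderiv_neg (m n : ℕ) (f : ℝ × ℝ → ℝ) (p : ℝ × ℝ) :
    pderiv m n (fun q => -f q) p = -pderiv m n f p := by
  have h1 : dy^[n] (fun q => -f q) = fun q => -dy^[n] f q := by
    funext q
    simp only [iterate_dy_apply, iteratedDeriv_fun_neg]
  rw [pderiv, h1]
  simp only [pderiv, iterate_dx_apply, iteratedDeriv_fun_neg]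

/-- The array of derivatives of a product, in terms of those of the factors. -/
noncomputable def leib (A B : ℕ → ℕ → ℝ) (m n : ℕ) : ℝ :=
  ∑ i ∈ Finset.range (m + 1), ∑ j ∈ Finset.range (n + 1),
    (m.choose i : ℝ) * (n.choose j : ℝ) * (A i j * B (m - i) (n - j))

theorem pderiv_mul (m n : ℕ) {f g : ℝ × ℝ → ℝ} {p : ℝ × ℝ} (hf : ContDiffAt ℝ (m + n : ℕ) f p)
    (hg : ContDiffAt ℝ (m + n : ℕ) g p) :
    pderiv m n (fun q => f q * g q) p = leib (jetAt f p) (jetAt g p) m n := by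
  -- The rule in `y` is needed on a whole neighbourhood, because it is differentiated in `x`
  -- afterwards.
  have h1 : dy^[n] (fun q => f q * g q) =ᶠ[𝓝 p] fun q => ∑ j ∈ Finset.range (n + 1),
      (n.choose j : ℝ) * (dy^[j] f q * dy^[n - j] g q) := by
    filter_upwards [(hf.of_nat_le (show n ≤ m + n by omega)).eventually (by simp),
      (hg.of_nat_le (show n ≤ m + n by omega)).eventually (by simp)] with q h1 h2
    simp only [iterate_dy_apply]
    rw [iteratedDeriv_fun_mul (contDiffAt_snd_slice h1) (contDiffAt_snd_slice h2)]
    simp only [mul_assoc]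
  have hfj : ∀ j ∈ Finset.range (n + 1),
      ContDiffAt ℝ m (fun s => dy^[j] f (s, p.2)) p.1 := fun j hj =>
    contDiffAt_fst_slice (contDiffAt_iterate_dy j
      (hf.of_nat_le (by have := Finset.mem_range.1 hj; omega)))
  have hgj : ∀ j ∈ Finset.range (n + 1),
      ContDiffAt ℝ m (fun s => dy^[n - j] g (s, p.2)) p.1 := fun j hj =>
    contDiffAt_fst_slice (contDiffAt_iterate_dy (n - j) (hg.of_nat_le (by omega)))
  rw [pderiv, (iterate_dx_congr m h1).eq_of_nhds, iterate_dx_apply,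
    iteratedDeriv_fun_sum fun j hj => contDiffAt_const.mul ((hfj j hj).mul (hgj j hj)), leib,
    Finset.sum_comm]
  refine Finset.sum_congr rfl fun j hj => ?_
  rw [iteratedDeriv_const_mul_field, iteratedDeriv_fun_mul (hfj j hj) (hgj j hj), Finset.mul_sum]
  refine Finset.sum_congr rfl fun i _ => ?_
  simp only [jetAt, pderiv, iterate_dx_apply]
  ring

/-! ### The jet of the elliptic operator -/

theorem dx_mul {f g : ℝ × ℝ → ℝ} {q : ℝ × ℝ} (hf : DifferentiableAt ℝ f q)
    (hg : DifferentiableAt ℝ g q) : dx (fun z => f z * g z) q = dx f q * g q + f q * dx g q := by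
  rw [dx_eq_fderiv hf, dx_eq_fderiv hg]
  exact ((hasDerivAt_fst hf).mul (hasDerivAt_fst hg)).deriv

theorem dy_mul {f g : ℝ × ℝ → ℝ} {q : ℝ × ℝ} (hf : DifferentiableAt ℝ f q)
    (hg : DifferentiableAt ℝ g q) : dy (fun z => f z * g z) q = dy f q * g q + f q * dy g q := by
  rw [dy_eq_fderiv hf, dy_eq_fderiv hg]
  exact ((hasDerivAt_snd hf).mul (hasDerivAt_snd hg)).deriv

/-- The jet of `∇·(a∇u)` in terms of the jet `α` of `a` and the jet `U` of `u`. -/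
noncomputable def divGradJet (α U : ℕ → ℕ → ℝ) (m n : ℕ) : ℝ :=
  ∑ i ∈ Finset.range (m + 1), ∑ j ∈ Finset.range (n + 1), (m.choose i : ℝ) * (n.choose j : ℝ) *
    (α i j * (U (m + 2 - i) (n - j) + U (m - i) (n + 2 - j))
      + (α (i + 1) j * U (m + 1 - i) (n - j) + α i (j + 1) * U (m - i) (n + 1 - j)))

theorem divGradJet_congr {α β U V : ℕ → ℕ → ℝ} {m n : ℕ}
    (hα : ∀ i j, i + j ≤ m + n + 1 → α i j = β i j)
    (hU : ∀ i j, i + j ≤ m + n + 2 → U i j = V i j) :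
    divGradJet α U m n = divGradJet β V m n := by
  refine Finset.sum_congr rfl fun i hi => Finset.sum_congr rfl fun j hj => ?_
  have hi := Finset.mem_range.1 hi
  have hj := Finset.mem_range.1 hj
  rw [hα i j (by omega), hα (i + 1) j (by omega), hα i (j + 1) (by omega),
    hU (m + 2 - i) (n - j) (by omega), hU (m - i) (n + 2 - j) (by omega),
    hU (m + 1 - i) (n - j) (by omega), hU (m - i) (n + 1 - j) (by omega)]

theorem ellip_eventuallyEq {a u : ℝ × ℝ → ℝ} {p : ℝ × ℝ} (ha : ContDiffAt ℝ (1 : ℕ) a p)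
    (hu : ContDiffAt ℝ (2 : ℕ) u p) :
    ellip a u =ᶠ[𝓝 p] fun q => -((a q * dx (dx u) q + dx a q * dx u q)
      + (a q * dy (dy u) q + dy a q * dy u q)) := by
  filter_upwards [eventually_differentiableAt (n := 0) ha,
    eventually_differentiableAt (n := 0) (contDiffAt_dx (n := 1) hu),
    eventually_differentiableAt (n := 0) (contDiffAt_dy (n := 1) hu)] with q h1 h2 h3
  simp only [ellip]
  rw [dx_mul h1 h2, dy_mul h1 h3]
  ring

theorem leib_congr {A B A' B' : ℕ → ℕ → ℝ} {m n : ℕ}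
    (hA : ∀ i j, i + j ≤ m + n → A i j = A' i j) (hB : ∀ i j, i + j ≤ m + n → B i j = B' i j) :
    leib A B m n = leib A' B' m n := by
  refine Finset.sum_congr rfl fun i hi => Finset.sum_congr rfl fun j hj => ?_
  have hi := Finset.mem_range.1 hi
  have hj := Finset.mem_range.1 hj
  rw [hA i j (by omega), hB (m - i) (n - j) (by omega)]

theorem jetAt_dx {g : ℝ × ℝ → ℝ} {p : ℝ × ℝ} {n : ℕ} (m : ℕ)
    (h : ContDiffAt ℝ (n + 1 : ℕ) g p) : jetAt (dx g) p m n = jetAt g p (m + 1) n :=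
  (pderiv_dx m n h).eq_of_nhds

/-- The Leibniz rule applied to `a u_xx + a_x u_x + a u_yy + a_y u_y`. This is the passage from the
differential equation to algebra on jets. -/
theorem pderiv_ellip (m n : ℕ) {a u : ℝ × ℝ → ℝ} {p : ℝ × ℝ}
    (ha : ContDiffAt ℝ (m + n + 1 : ℕ) a p) (hu : ContDiffAt ℝ (m + n + 2 : ℕ) u p) :
    pderiv m n (ellip a u) p = -divGradJet (jetAt a p) (jetAt u p) m n := by
  rw [(pderiv_congr m n (ellip_eventuallyEq (ha.of_nat_le (by omega))
    (hu.of_nat_le (by omega)))).eq_of_nhds, pderiv_neg]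
  have ha0 : ContDiffAt ℝ (m + n : ℕ) a p := ha.of_nat_le (by omega)
  have hax := contDiffAt_dx ha
  have hay := contDiffAt_dy ha
  have hux := contDiffAt_dx hu
  have huy := contDiffAt_dy hu
  have hux0 : ContDiffAt ℝ (m + n : ℕ) (dx u) p := hux.of_nat_le (by omega)
  have huy0 : ContDiffAt ℝ (m + n : ℕ) (dy u) p := huy.of_nat_le (by omega)
  have huxx := contDiffAt_dx hux
  have huyy := contDiffAt_dy huy
  rw [pderiv_add m n ((ha0.mul huxx).add (hax.mul hux0)) ((ha0.mul huyy).add (hay.mul huy0)),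
    pderiv_add m n (ha0.mul huxx) (hax.mul hux0), pderiv_add m n (ha0.mul huyy) (hay.mul huy0),
    pderiv_mul m n ha0 huxx, pderiv_mul m n hax hux0, pderiv_mul m n ha0 huyy,
    pderiv_mul m n hay huy0]
  simp only [leib, divGradJet, ← Finset.sum_add_distrib]
  congr 1
  refine Finset.sum_congr rfl fun i hi => Finset.sum_congr rfl fun j hj => ?_
  have hi := Finset.mem_range.1 hi
  have hj := Finset.mem_range.1 hj
  rw [jetAt_dx i (ha.of_nat_le (by omega)), jetAt_dx (m - i) (hux.of_nat_le (by omega)),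
    jetAt_dx (m - i + 1) (hu.of_nat_le (by omega)), jetAt_dx (m - i) (hu.of_nat_le (by omega)),
    show m + 2 - i = m - i + 1 + 1 by omega, show n + 2 - j = n - j + 1 + 1 by omega,
    show m + 1 - i = m - i + 1 by omega, show n + 1 - j = n - j + 1 by omega]
  simp only [jetAt, ← pderiv_dy]
  ring

/-! ### Taylor polynomials -/

theorem sum_Lam (K : ℕ) (F : ℕ × ℕ → ℝ) :
    ∑ μ ∈ Lam K, F μ = ∑ i ∈ Finset.range (K + 1), ∑ j ∈ Finset.range (K + 1 - i), F (i, j) := by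
  rw [← Finset.sum_finset_product' (r := Lam K) (f := fun i j => F (i, j))]
  rintro ⟨i, j⟩
  simp only [Lam, Finset.mem_filter, Finset.mem_product, Finset.mem_range]
  omega

theorem sum_Lam' (K : ℕ) (F : ℕ × ℕ → ℝ) :
    ∑ μ ∈ Lam K, F μ = ∑ j ∈ Finset.range (K + 1), ∑ i ∈ Finset.range (K + 1 - j), F (i, j) := by
  rw [← Finset.sum_finset_product_right' (r := Lam K) (f := fun i j => F (i, j))]
  rintro ⟨i, j⟩
  simp only [Lam, Finset.mem_filter, Finset.mem_product, Finset.mem_range]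
  omega

theorem mem_Lam {K : ℕ} {μ : ℕ × ℕ} : μ ∈ Lam K ↔ μ.1 + μ.2 ≤ K := by
  simp only [Lam, Finset.mem_filter, Finset.mem_product, Finset.mem_range]
  omega

/-- The polynomial of degree `K` whose derivatives at the origin are `U`. -/
noncomputable def taylorPoly (K : ℕ) (U : ℕ → ℕ → ℝ) (x y : ℝ) : ℝ :=
  ∑ μ ∈ Lam K, U μ.1 μ.2 * (x ^ μ.1 * y ^ μ.2 / (μ.1.factorial * μ.2.factorial))

theorem taylorPoly_zero (U : ℕ → ℕ → ℝ) (x y : ℝ) : taylorPoly 0 U x y = U 0 0 := by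
  simp [taylorPoly, sum_Lam]

theorem taylorPoly_origin (K : ℕ) (U : ℕ → ℕ → ℝ) : taylorPoly K U 0 0 = U 0 0 := by
  rw [taylorPoly, sum_Lam, Finset.sum_range_succ', Finset.sum_eq_zero, zero_add, Nat.sub_zero,
    Finset.sum_range_succ', Finset.sum_eq_zero]
  · simp
  · simp
  · simp

theorem hasDerivAt_pow_div_factorial {x : ℝ → ℝ} {x' t : ℝ} (hx : HasDerivAt x x' t) (i : ℕ) :
    HasDerivAt (fun t => x t ^ (i + 1) / (i + 1).factorial) (x' * (x t ^ i / i.factorial)) t := by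
  refine ((hx.pow (i + 1)).div_const ((i + 1).factorial : ℝ)).congr_deriv ?_
  have : (i.factorial : ℝ) ≠ 0 := by positivity
  have : (i + 1 : ℝ) ≠ 0 := by positivity
  push_cast [Nat.factorial_succ]
  field_simp

theorem hasDerivAt_taylorPoly (K : ℕ) (U : ℕ → ℕ → ℝ) {x y : ℝ → ℝ} {x' y' t : ℝ}
    (hx : HasDerivAt x x' t) (hy : HasDerivAt y y' t) :
    HasDerivAt (fun t => taylorPoly (K + 1) U (x t) (y t))
      (x' * taylorPoly K (fun i j => U (i + 1) j) (x t) (y t)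
        + y' * taylorPoly K (fun i j => U i (j + 1)) (x t) (y t)) t := by
  have hpow : ∀ {z : ℝ → ℝ} {z' : ℝ}, HasDerivAt z z' t → ∀ i : ℕ,
      HasDerivAt (fun t => z t ^ i / i.factorial)
        (if i = 0 then 0 else z' * (z t ^ (i - 1) / (i - 1).factorial)) t := by
    intro z z' hz i
    rcases i with _ | i
    · simpa using hasDerivAt_const t (1 : ℝ)
    · simpa using hasDerivAt_pow_div_factorial hz i
  have hsum := HasDerivAt.fun_sum (u := Lam (K + 1)) fun μ _ =>
    ((hpow hx μ.1).mul (hpow hy μ.2)).const_mul (U μ.1 μ.2)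
  refine (hsum.congr_of_eventuallyEq (Eventually.of_forall fun t => ?_)).congr_deriv (Eq.symm ?_)
  · simp only [taylorPoly, Pi.mul_apply, mul_div_mul_comm]
  · simp only [mul_add, Finset.sum_add_distrib]
    congr 1
    -- The outer index is that of the differentiated variable, so that splitting off its zeroth term
    -- removes exactly the monomials with zero derivative. The `y` part uses `sum_Lam'` for the same
    -- reason.
    · rw [sum_Lam, Finset.sum_range_succ', taylorPoly, sum_Lam, Finset.mul_sum]
      simp only [Nat.succ_sub_succ_eq_sub, if_true, zero_mul, mul_zero, Finset.sum_const_zero,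
        add_zero, Finset.mul_sum]
      refine Finset.sum_congr rfl fun i _ => Finset.sum_congr rfl fun j _ => ?_
      simp only [Nat.add_eq_zero_iff, one_ne_zero, and_false, if_false, Nat.sub_zero]
      ring
    · rw [sum_Lam', Finset.sum_range_succ', taylorPoly, sum_Lam', Finset.mul_sum]
      simp only [Nat.succ_sub_succ_eq_sub, if_true, mul_zero, Finset.sum_const_zero,
        add_zero, Finset.mul_sum]
      refine Finset.sum_congr rfl fun i _ => Finset.sum_congr rfl fun j _ => ?_
      simp only [Nat.add_eq_zero_iff, one_ne_zero, and_false, if_false, Nat.sub_zero]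
      ring

/-- The polynomial function with derivatives `U` at `p`. -/
noncomputable def polyAt (K : ℕ) (U : ℕ → ℕ → ℝ) (p : ℝ × ℝ) : ℝ × ℝ → ℝ :=
  fun q => taylorPoly K U (q.1 - p.1) (q.2 - p.2)

theorem contDiff_polyAt (K : ℕ) (U : ℕ → ℕ → ℝ) (p : ℝ × ℝ) {n : WithTop ℕ∞} :
    ContDiff ℝ n (polyAt K U p) := by
  unfold polyAt taylorPoly
  fun_prop

theorem dx_polyAt (K : ℕ) (U : ℕ → ℕ → ℝ) (p : ℝ × ℝ) :
    dx (polyAt (K + 1) U p) = polyAt K (fun i j => U (i + 1) j) p := by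
  funext q
  have h := hasDerivAt_taylorPoly K U ((hasDerivAt_id q.1).sub_const p.1)
    (hasDerivAt_const q.1 (q.2 - p.2))
  simpa [polyAt, dx] using h.deriv

theorem dy_polyAt (K : ℕ) (U : ℕ → ℕ → ℝ) (p : ℝ × ℝ) :
    dy (polyAt (K + 1) U p) = polyAt K (fun i j => U i (j + 1)) p := by
  funext q
  have h := hasDerivAt_taylorPoly K U (hasDerivAt_const q.2 (q.1 - p.1))
    ((hasDerivAt_id q.2).sub_const p.2)
  simpa [polyAt, dy] using h.deriv

theorem pderiv_polyAt (r m n : ℕ) (U : ℕ → ℕ → ℝ) (p : ℝ × ℝ) :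
    pderiv m n (polyAt (r + m + n) U p) = polyAt r (fun i j => U (i + m) (j + n)) p := by
  have hy : ∀ (n K : ℕ) (U : ℕ → ℕ → ℝ),
      dy^[n] (polyAt (K + n) U p) = polyAt K (fun i j => U i (j + n)) p := by
    intro n
    induction n with
    | zero => intro K U; rfl
    | succ n ih =>
      intro K U
      rw [Function.iterate_succ_apply, ← add_assoc, dy_polyAt, ih]
      simp only [add_assoc]
  have hx : ∀ (m K : ℕ) (U : ℕ → ℕ → ℝ),
      dx^[m] (polyAt (K + m) U p) = polyAt K (fun i j => U (i + m) j) p := by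
    intro m
    induction m with
    | zero => intro K U; rfl
    | succ m ih =>
      intro K U
      rw [Function.iterate_succ_apply, ← add_assoc, dx_polyAt, ih]
      simp only [add_assoc]
  rw [pderiv, hy, hx]

theorem jetAt_polyAt {K m n : ℕ} (h : m + n ≤ K) (U : ℕ → ℕ → ℝ) (p : ℝ × ℝ) :
    jetAt (polyAt K U p) p m n = U m n := by
  obtain ⟨r, rfl⟩ : ∃ r, K = r + m + n := ⟨K - m - n, by omega⟩
  rw [jetAt, pderiv_polyAt, polyAt, sub_self, sub_self, taylorPoly_origin, zero_add, zero_add]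

/-! ### Taylor expansion along a ray -/

/-- The mean value inequality on the segment from `0` to `t`, where the derivative is at most `c
|t|^n`. -/
theorem isBigO_pow_succ_of_hasDerivAt {F F' : ℝ → ℝ} {n : ℕ} (h0 : F 0 = 0)
    (hF : ∀ᶠ t in 𝓝 0, HasDerivAt F (F' t) t) (hO : F' =O[𝓝 0] fun t => t ^ n) :
    F =O[𝓝 0] fun t => t ^ (n + 1) := by
  obtain ⟨c, hc⟩ := hO.bound
  obtain ⟨ε, hε, hball⟩ := Metric.eventually_nhds_iff_ball.1 (hF.and hc)
  refine Asymptotics.IsBigO.of_bound c ?_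
  filter_upwards [Metric.ball_mem_nhds 0 hε] with t ht
  have hsub : ∀ s ∈ uIcc 0 t, s ∈ Metric.ball (0 : ℝ) ε ∧ |s| ≤ |t| := by
    intro s hs
    have h1 : |s| ≤ |t| := by
      have := abs_sub_left_of_mem_uIcc hs
      simpa using this
    refine ⟨?_, h1⟩
    simp only [Metric.mem_ball, dist_zero_right, Real.norm_eq_abs] at ht ⊢
    exact h1.trans_lt ht
  have hcn : ∀ s ∈ uIcc 0 t, ‖F' s‖ ≤ c * |t| ^ n := by
    intro s hs
    have h1 := (hball s (hsub s hs).1).2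
    rw [norm_pow, Real.norm_eq_abs s] at h1
    have hc0 : 0 ≤ c ∨ |s| ^ n = 0 := by
      by_contra hcon
      push Not at hcon
      have : 0 < |s| ^ n := lt_of_le_of_ne (by positivity) (Ne.symm hcon.2)
      nlinarith [norm_nonneg (F' s), mul_neg_of_neg_of_pos hcon.1 this]
    -- The big-O bound comes with a constant of unknown sign; its instance at the nonzero point `ε /
    -- 2` forces the sign.
    have hcc : 0 ≤ c := by
      by_contra hcon
      have h2 := (hball (ε / 2) (by simp [abs_of_pos hε]; linarith)).2
      have h3 : 0 < ‖(ε / 2) ^ n‖ := norm_pos_iff.2 (by positivity)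
      nlinarith [norm_nonneg (F' (ε / 2)), mul_neg_of_neg_of_pos (not_le.1 hcon) h3]
    exact h1.trans (by have := (hsub s hs).2; gcongr)
  have := (convex_uIcc 0 t).norm_image_sub_le_of_norm_hasDerivWithin_le
    (fun s hs => (hball s (hsub s hs).1).1.hasDerivWithinAt) hcn left_mem_uIcc right_mem_uIcc
  rw [h0, sub_zero, sub_zero] at this
  calc ‖F t‖ ≤ c * |t| ^ n * ‖t‖ := this
    _ = c * ‖t ^ (n + 1)‖ := by rw [norm_pow, Real.norm_eq_abs, pow_succ, mul_assoc]

theorem tendsto_ray (p : ℝ × ℝ) (k l : ℝ) :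
    Tendsto (fun h : ℝ => (p.1 + k * h, p.2 + l * h)) (𝓝 0) (𝓝 p) :=
  Continuous.tendsto' (by fun_prop) _ _ (by simp)

/-- Induction on `K`: the derivative along the ray of the remainder of `g` is `k` and `l` times the
remainders of `dx g` and `dy g`, one order lower. At order zero only the Lipschitz-type bound at `p`
is left, so no derivative of order `K + 1` is required. -/
theorem taylor_ray (K : ℕ) {g : ℝ × ℝ → ℝ} {p : ℝ × ℝ} (hg : ContDiffAt ℝ K g p)
    (hlip : ∀ m n, m + n = K →
      (fun q => pderiv m n g q - pderiv m n g p) =O[𝓝 p] fun q => q - p) (k l : ℝ) :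
    (fun h : ℝ => g (p.1 + k * h, p.2 + l * h) - taylorPoly K (jetAt g p) (k * h) (l * h))
      =O[𝓝 0] fun h => h ^ (K + 1) := by
  induction K generalizing g with
  | zero =>
    have h1 := (hlip 0 0 rfl).comp_tendsto (tendsto_ray p k l)
    simp only [taylorPoly_zero]
    refine h1.trans ?_
    have : (fun q => q - p) ∘ (fun h : ℝ => (p.1 + k * h, p.2 + l * h))
        = fun h : ℝ => h • ((k, l) : ℝ × ℝ) := by
      funext h
      ext <;> simp [mul_comm]
    rw [this]
    refine Asymptotics.IsBigO.of_bound ‖((k, l) : ℝ × ℝ)‖ (Eventually.of_forall fun h => ?_)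
    rw [norm_smul, zero_add, pow_one, mul_comm]
  | succ K ih =>
    have hx := contDiffAt_dx hg
    have hy := contDiffAt_dy hg
    have e : ∀ m n, m + n = K → pderiv m n (dx g) =ᶠ[𝓝 p] pderiv (m + 1) n g :=
      fun m n hmn => pderiv_dx m n (hg.of_nat_le (by omega))
    have ihx := ih hx fun m n hmn => by
      refine (hlip (m + 1) n (by omega)).congr' ?_ EventuallyEq.rfl
      filter_upwards [e m n hmn] with q hq
      rw [hq, (e m n hmn).eq_of_nhds]
    have ihy := ih hy fun m n hmn => hlip m (n + 1) (by omega)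
    refine isBigO_pow_succ_of_hasDerivAt (F' := fun h =>
      k * (dx g (p.1 + k * h, p.2 + l * h) - taylorPoly K (jetAt (dx g) p) (k * h) (l * h))
      + l * (dy g (p.1 + k * h, p.2 + l * h) - taylorPoly K (jetAt (dy g) p) (k * h) (l * h)))
      ?_ ?_ ((ihx.const_mul_left k).add (ihy.const_mul_left l))
    · simp only [mul_zero, add_zero, taylorPoly_origin]
      exact sub_self _
    · filter_upwards [(tendsto_ray p k l).eventually (eventually_differentiableAt hg)] with h hh
      have hX : HasDerivAt (fun h : ℝ => k * h) k h := by
        simpa using (hasDerivAt_id h).const_mul k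
      have hY : HasDerivAt (fun h : ℝ => l * h) l h := by
        simpa using (hasDerivAt_id h).const_mul l
      have h1 := HasFDerivAt.comp_hasDerivAt h
        (f := fun h : ℝ => (p.1 + k * h, p.2 + l * h)) hh.hasFDerivAt
        ((hX.const_add p.1).prodMk (hY.const_add p.2))
      refine (h1.sub (hasDerivAt_taylorPoly K (jetAt g p) hX hY)).congr_deriv ?_
      have e1 : taylorPoly K (jetAt (dx g) p) (k * h) (l * h)
          = taylorPoly K (fun i j => jetAt g p (i + 1) j) (k * h) (l * h) := by
        refine Finset.sum_congr rfl fun μ hμ => ?_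
        rw [jetAt_dx μ.1 (hg.of_nat_le (by have := mem_Lam.1 hμ; omega))]
      have e2 : ((k, l) : ℝ × ℝ) = k • ((1 : ℝ), (0 : ℝ)) + l • ((0 : ℝ), (1 : ℝ)) := by
        ext <;> simp
      have e3 : taylorPoly K (jetAt (dy g) p) (k * h) (l * h)
          = taylorPoly K (fun i j => jetAt g p i (j + 1)) (k * h) (l * h) := rfl
      rw [e1, e3, dx_eq_fderiv hh, dy_eq_fderiv hh, e2, map_add, map_smul, map_smul]
      simp only [smul_eq_mul]
      ring

theorem isBigO_sub_of_contDiffAt {g : ℝ × ℝ → ℝ} {p : ℝ × ℝ} (hg : ContDiffAt ℝ (1 : ℕ) g p) :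
    (fun q => g q - g p) =O[𝓝 p] fun q => q - p :=
  (hg.differentiableAt (by simp)).isBigO_sub

theorem taylor_ray_of_contDiffAt (K : ℕ) {g : ℝ × ℝ → ℝ} {p : ℝ × ℝ}
    (hg : ContDiffAt ℝ (K + 1 : ℕ) g p) (k l : ℝ) :
    (fun h : ℝ => g (p.1 + k * h, p.2 + l * h) - taylorPoly K (jetAt g p) (k * h) (l * h))
      =O[𝓝 0] fun h => h ^ (K + 1) :=
  taylor_ray K (hg.of_nat_le (by omega)) (fun m n hmn =>
    isBigO_sub_of_contDiffAt (contDiffAt_pderiv m n (hg.of_nat_le (by omega)))) k l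

/-! ### The recursion for the jet of a solution -/

/-- The part of `divGradJet` that involves derivatives of `u` of order below `m + n + 2`. -/
noncomputable def divGradLower (α U : ℕ → ℕ → ℝ) (m n : ℕ) : ℝ :=
  ∑ i ∈ Finset.range (m + 1), ∑ j ∈ Finset.range (n + 1), (m.choose i : ℝ) * (n.choose j : ℝ) *
    (if i + j = 0 then 0 else α i j * (U (m + 2 - i) (n - j) + U (m - i) (n + 2 - j)))
  + ∑ i ∈ Finset.range (m + 1), ∑ j ∈ Finset.range (n + 1), (m.choose i : ℝ) * (n.choose j : ℝ) *
    (α (i + 1) j * U (m + 1 - i) (n - j) + α i (j + 1) * U (m - i) (n + 1 - j))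

/-- Only the term `i = j = 0` contains derivatives of `u` of the top order; it is the Laplacian
times `α 0 0`. -/
theorem divGradJet_eq (α U : ℕ → ℕ → ℝ) (m n : ℕ) :
    divGradJet α U m n = α 0 0 * (U (m + 2) n + U m (n + 2)) + divGradLower α U m n := by
  have key : ∀ X : ℕ → ℕ → ℝ,
      ∑ i ∈ Finset.range (m + 1), ∑ j ∈ Finset.range (n + 1),
        (m.choose i : ℝ) * (n.choose j : ℝ) * X i j
      = X 0 0 + ∑ i ∈ Finset.range (m + 1), ∑ j ∈ Finset.range (n + 1),
        (m.choose i : ℝ) * (n.choose j : ℝ) * (if i + j = 0 then 0 else X i j) := by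
    intro X
    simp [Finset.sum_range_succ']
    ring
  rw [divGradJet, divGradLower, ← add_assoc]
  simp only [mul_add (_ * _), Finset.sum_add_distrib]
  congr 1
  simpa [mul_add, Finset.sum_add_distrib] using
    key fun i j => α i j * (U (m + 2 - i) (n - j) + U (m - i) (n + 2 - j))

theorem divGradLower_congr (α : ℕ → ℕ → ℝ) {U V : ℕ → ℕ → ℝ} {m n : ℕ}
    (h : ∀ i j, i + j < m + n + 2 → U i j = V i j) :
    divGradLower α U m n = divGradLower α V m n := by
  refine congrArg₂ (· + ·) ?_ ?_ <;>
    refine Finset.sum_congr rfl fun i hi => Finset.sum_congr rfl fun j hj => ?_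
  · have hi := Finset.mem_range.1 hi
    have hj := Finset.mem_range.1 hj
    split_ifs with hij
    · rfl
    · rw [h (m + 2 - i) (n - j) (by omega), h (m - i) (n + 2 - j) (by omega)]
  · have hi := Finset.mem_range.1 hi
    have hj := Finset.mem_range.1 hj
    rw [h (m + 1 - i) (n - j) (by omega), h (m - i) (n + 1 - j) (by omega)]

theorem divGradLower_eq_zero (α : ℕ → ℕ → ℝ) {U : ℕ → ℕ → ℝ} {m n : ℕ}
    (h : ∀ i j, i + j < m + n + 2 → U i j = 0) : divGradLower α U m n = 0 := by
  rw [divGradLower_congr α (V := fun _ _ => 0) h]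
  simp [divGradLower]

theorem divGradJet_add (α U V : ℕ → ℕ → ℝ) (m n : ℕ) :
    divGradJet α (fun i j => U i j + V i j) m n = divGradJet α U m n + divGradJet α V m n := by
  simp only [divGradJet, ← Finset.sum_add_distrib]
  refine Finset.sum_congr rfl fun i _ => Finset.sum_congr rfl fun j _ => ?_
  ring

theorem divGradJet_sum {ι : Type*} (α : ℕ → ℕ → ℝ) (s : Finset ι) (c : ι → ℝ)
    (U : ι → ℕ → ℕ → ℝ) (m n : ℕ) :
    divGradJet α (fun i j => ∑ κ ∈ s, c κ * U κ i j) m n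
      = ∑ κ ∈ s, c κ * divGradJet α (U κ) m n := by
  have e : ∑ κ ∈ s, c κ * divGradJet α (U κ) m n = ∑ i ∈ Finset.range (m + 1),
      ∑ j ∈ Finset.range (n + 1), ∑ κ ∈ s, c κ * ((m.choose i : ℝ) * (n.choose j : ℝ) *
        (α i j * (U κ (m + 2 - i) (n - j) + U κ (m - i) (n + 2 - j))
        + (α (i + 1) j * U κ (m + 1 - i) (n - j) + α i (j + 1) * U κ (m - i) (n + 1 - j)))) := by
    rw [Finset.sum_congr rfl fun i _ => Finset.sum_comm, Finset.sum_comm]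
    simp only [divGradJet, Finset.mul_sum]
  rw [e, divGradJet]
  refine Finset.sum_congr rfl fun i _ => Finset.sum_congr rfl fun j _ => ?_
  simp only [← Finset.sum_add_distrib, Finset.mul_sum]
  refine Finset.sum_congr rfl fun κ _ => ?_
  ring

theorem solJet_add_two (α v φ : ℕ → ℕ → ℝ) (m n : ℕ) :
    solJet α v φ (m + 2) n = -(α 0 0)⁻¹ * (φ m n + α 0 0 * solJet α v φ m (n + 2)
      + divGradLower α (solJet α v φ) m n) := by
  rw [solJet, divGradLower, add_assoc (φ m n + _)]
  simp only [Finset.sum_range, dite_eq_ite]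

/-- With `solJet_of_le_one` and `jet_unique` this characterises `solJet`, and later arguments use
the characterisation in place of the recursion. -/
theorem divGradJet_solJet {α : ℕ → ℕ → ℝ} (hα : α 0 0 ≠ 0) (v φ : ℕ → ℕ → ℝ) (m n : ℕ) :
    divGradJet α (solJet α v φ) m n = -φ m n := by
  rw [divGradJet_eq, solJet_add_two]
  field_simp
  ring

theorem solJet_of_le_one (α v φ : ℕ → ℕ → ℝ) {m : ℕ} (hm : m ≤ 1) (n : ℕ) :
    solJet α v φ m n = v m n := by
  interval_cases m <;> rw [solJet]

/-- A jet is determined, up to order `K`, by its entries with `m ≤ 1` and by the differentiated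
equation. -/
theorem jet_unique {α U V : ℕ → ℕ → ℝ} (hα : α 0 0 ≠ 0) {K : ℕ}
    (h1 : ∀ m n, m ≤ 1 → m + n ≤ K → U m n = V m n)
    (heq : ∀ m n, m + n + 2 ≤ K → divGradJet α U m n = divGradJet α V m n) :
    ∀ m n, m + n ≤ K → U m n = V m n := by
  -- Induction on the order `s` and, inside it, on `m`: the equation gives the entry `(m + 2, n)`
  -- from lower orders and from `(m, n + 2)`, which has the same order but smaller first index.
  have main : ∀ s m n, m + n = s → s ≤ K → U m n = V m n := by
    intro s
    induction s using Nat.strong_induction_on with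
    | _ s ihs =>
      intro m
      induction m using Nat.strong_induction_on with
      | _ m ihm =>
        intro n hmn hs
        rcases Nat.lt_or_ge 1 m with hm | hm
        · obtain ⟨m, rfl⟩ : ∃ k, m = k + 2 := ⟨m - 2, by omega⟩
          have e := heq m n (by omega)
          rw [divGradJet_eq, divGradJet_eq, divGradLower_congr α (V := V)
            fun i j hij => ihs (i + j) (by omega) i j rfl (by omega),
            ihm m (by omega) (n + 2) (by omega) hs] at e
          have := mul_left_cancel₀ hα (add_right_cancel e)
          linarith
        · exact h1 m n hm (by omega)
  exact fun m n h => main _ m n rfl h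

theorem mem_LamV1 {K : ℕ} {μ : ℕ × ℕ} : μ ∈ LamV1 K ↔ μ.1 + μ.2 ≤ K ∧ μ.1 ≤ 1 := by
  rw [LamV1, Finset.mem_filter, mem_Lam]

theorem mem_LamV2 {K : ℕ} {μ : ℕ × ℕ} : μ ∈ LamV2 K ↔ μ.1 + μ.2 ≤ K ∧ 2 ≤ μ.1 := by
  rw [LamV2, Finset.mem_sdiff, mem_Lam, mem_LamV1]
  omega

theorem sum_mul_unitJet (s : Finset (ℕ × ℕ)) (F : ℕ → ℕ → ℝ) {m n : ℕ} (h : (m, n) ∈ s) :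
    ∑ μ ∈ s, F μ.1 μ.2 * unitJet μ.1 μ.2 m n = F m n := by
  rw [Finset.sum_eq_single_of_mem (m, n) h]
  · simp [unitJet]
  · rintro ⟨i, j⟩ _ hne
    have : ¬(m = i ∧ n = j) := fun hc => hne (by rw [hc.1, hc.2])
    simp [unitJet, this]

/-- Every jet satisfying the differentiated equation is the combination, with coefficients
`A^{V,u}` and `A^{V,f}`, of the `u^{(m,n)}` with `m ≤ 1` and the `f^{(m,n)}`. -/
theorem jet_eq_sum {α U φ : ℕ → ℕ → ℝ} (hα : α 0 0 ≠ 0) {k : ℕ}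
    (heq : ∀ m n, m + n ≤ k → divGradJet α U m n = -φ m n) (m n : ℕ) (hmn : m + n ≤ k + 2) :
    U m n = ∑ μ ∈ LamV1 (k + 2), U μ.1 μ.2 * AVu α m n μ.1 μ.2
      + ∑ μ ∈ Lam k, φ μ.1 μ.2 * AVf α m n μ.1 μ.2 := by
  -- Both sides have the same entries with `m ≤ 1` and satisfy the same equation, by linearity of
  -- `divGradJet` in the jet.
  refine jet_unique (K := k + 2) (V := fun m n => ∑ μ ∈ LamV1 (k + 2), U μ.1 μ.2 *
    solJet α (unitJet μ.1 μ.2) 0 m n + ∑ μ ∈ Lam k, φ μ.1 μ.2 * solJet α 0 (unitJet μ.1 μ.2) m n)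
    hα ?_ ?_ m n hmn
  · intro m n hm hmn
    simp only [solJet_of_le_one _ _ _ hm]
    rw [sum_mul_unitJet _ _ (mem_LamV1.2 ⟨hmn, hm⟩)]
    simp
  · intro m n hmn
    rw [divGradJet_add, divGradJet_sum α _ (fun μ : ℕ × ℕ => U μ.1 μ.2)
      (fun μ => solJet α (unitJet μ.1 μ.2) 0), divGradJet_sum α _ (fun μ : ℕ × ℕ => φ μ.1 μ.2)
      (fun μ => solJet α 0 (unitJet μ.1 μ.2))]
    simp only [divGradJet_solJet hα, Pi.zero_apply, neg_zero, mul_zero, Finset.sum_const_zero,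
      zero_add, mul_neg, Finset.sum_neg_distrib]
    rw [sum_mul_unitJet _ _ (mem_Lam.2 (show m + n ≤ k by omega)), heq m n (by omega)]

/-! ### Harmonic leading parts of the basic jets. -/

/-- The jet of the homogeneous polynomial of degree `S`, harmonic up to its first coefficient,
whose first nonzero derivative is `u^{(b, S - b)} = 1`. -/
noncomputable def harmJet (S b m n : ℕ) : ℝ :=
  if m + n = S ∧ b ≤ m ∧ Even (m - b) then (-1) ^ ((m - b) / 2) else 0

theorem harmJet_of_lt {S b m n : ℕ} (h : m + n < S) : harmJet S b m n = 0 :=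
  if_neg fun hc => by omega

/-- Consecutive entries alternate in sign and cancel; only the first one, at `m + 2 = b`, has no
partner. -/
theorem harmJet_add (S b m n : ℕ) : harmJet S b (m + 2) n + harmJet S b m (n + 2)
    = if m + n + 2 = S ∧ b = m + 2 then 1 else 0 := by
  unfold harmJet
  by_cases hS : m + n + 2 = S
  · rcases lt_trichotomy b (m + 2) with hb | hb | hb
    · rcases Nat.lt_or_ge m b with hb' | hb'
      · have : b = m + 1 := by omega
        subst this
        rw [if_neg, if_neg, if_neg] <;> simp
      · by_cases he : Even (m - b)
        · have he' : Even (m + 2 - b) := by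
            rw [show m + 2 - b = m - b + 2 by omega]; exact he.add even_two
          rw [if_pos ⟨by omega, by omega, he'⟩, if_pos ⟨by omega, by omega, he⟩,
            if_neg (by omega), show (m + 2 - b) / 2 = (m - b) / 2 + 1 by omega, pow_succ]
          ring
        · have he' : ¬Even (m + 2 - b) := by
            rw [show m + 2 - b = m - b + 2 by omega, Nat.even_add]; simpa using he
          rw [if_neg (fun h => he' h.2.2), if_neg (fun h => he h.2.2), if_neg (by omega), add_zero]
    · subst hb
      rw [if_pos ⟨by omega, le_rfl, by simp⟩, if_neg (by omega), if_pos ⟨hS, rfl⟩]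
      simp
    · rw [if_neg (by omega), if_neg (by omega), if_neg (by omega), add_zero]
  · rw [if_neg (by omega), if_neg (by omega), if_neg (by omega), add_zero]

theorem divGradJet_const_mul_harmJet (α : ℕ → ℕ → ℝ) (c : ℝ) {S b m n : ℕ} (h : m + n + 2 ≤ S) :
    divGradJet α (fun i j => c * harmJet S b i j) m n
      = α 0 0 * c * if m + n + 2 = S ∧ b = m + 2 then 1 else 0 := by
  rw [divGradJet_eq, divGradLower_eq_zero α fun i j hij => by
    rw [harmJet_of_lt (by omega), mul_zero], ← mul_add, harmJet_add]
  ring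

/-- Below order `m + n` the jet vanishes, so at that order the lower-order terms of the equation
drop out and the Laplace equation remains. -/
theorem AVu_of_le {α : ℕ → ℕ → ℝ} (hα : α 0 0 ≠ 0) {m n m' n' : ℕ} (hm : m ≤ 1)
    (h : m' + n' ≤ m + n) : AVu α m' n' m n = 1 * harmJet (m + n) m m' n' := by
  refine jet_unique (K := m + n) (U := solJet α (unitJet m n) 0)
    (V := fun i j => 1 * harmJet (m + n) m i j) hα ?_ ?_ m' n' h
  · intro i j hi hij
    rw [solJet_of_le_one _ _ _ hi, unitJet, harmJet, one_mul]
    by_cases hc : i = m ∧ j = n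
    · rw [if_pos hc, if_pos ⟨by omega, by omega, by simp [hc.1]⟩]
      simp [hc.1]
    · rw [if_neg hc, if_neg]
      rintro ⟨h1, h2, h3⟩
      have : i - m = 0 ∨ i - m = 1 := by omega
      rcases this with h4 | h4
      · omega
      · rw [h4] at h3
        exact absurd h3 (by decide)
  · intro i j hij
    rw [divGradJet_solJet hα, divGradJet_const_mul_harmJet α 1 hij, if_neg (by omega)]
    simp

/-- As in `AVu_of_le`, but the unit source enters at order `m + n + 2` and gives the factor `-(α 0
0)⁻¹`. Starting at first index `m + 2` makes the entries with first index at most one vanish. -/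
theorem AVf_of_le {α : ℕ → ℕ → ℝ} (hα : α 0 0 ≠ 0) {m n m' n' : ℕ}
    (h : m' + n' ≤ m + n + 2) :
    AVf α m' n' m n = -(α 0 0)⁻¹ * harmJet (m + n + 2) (m + 2) m' n' := by
  refine jet_unique (K := m + n + 2) (U := solJet α 0 (unitJet m n))
    (V := fun i j => -(α 0 0)⁻¹ * harmJet (m + n + 2) (m + 2) i j) hα ?_ ?_ m' n' h
  · intro i j hi hij
    rw [solJet_of_le_one _ _ _ hi, harmJet, if_neg (by omega)]
    simp
  · intro i j hij
    rw [divGradJet_solJet hα, divGradJet_const_mul_harmJet α _ (by omega), unitJet]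
    by_cases hc : i = m ∧ j = n
    · rw [if_pos hc, if_pos (by omega)]
      field_simp
    · rw [if_neg hc, if_neg (by omega)]
      simp

/-- A homogeneous polynomial of degree `S`, see `harmJet`. -/
noncomputable def harmPoly (S b : ℕ) (x y : ℝ) : ℝ :=
  ∑ l ∈ Finset.range ((S - b) / 2 + 1), (-1) ^ l * x ^ (b + 2 * l) * y ^ (S - b - 2 * l)
    / ((b + 2 * l).factorial * (S - b - 2 * l).factorial)

/-- Entries of order at most `S` contribute the harmonic part, and those of higher order are nonzero
only if their first index is at least two. This is the shape of the two sums in `GV` and `QV`. -/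
theorem taylorPoly_eq_harmPoly_add {K S b : ℕ} (hb : b ≤ S) (hS : S ≤ K) (c : ℝ)
    {U : ℕ → ℕ → ℝ} (hU : ∀ i j, i + j ≤ S → U i j = c * harmJet S b i j)
    (h1 : ∀ i j, i ≤ 1 → S < i + j → U i j = 0) (x y : ℝ) :
    taylorPoly K U x y = c * harmPoly S b x y + ∑ μ ∈ LamV2 K \ LamV2 S,
      U μ.1 μ.2 * (x ^ μ.1 * y ^ μ.2 / (μ.1.factorial * μ.2.factorial)) := by
  have hD : LamV2 K \ LamV2 S ⊆ Lam K := by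
    intro μ hμ
    rw [Finset.mem_sdiff, mem_LamV2] at hμ
    exact mem_Lam.2 hμ.1.1
  rw [taylorPoly, ← Finset.sum_sdiff hD]
  congr 1
  let e : ℕ → ℕ × ℕ := fun l => (b + 2 * l, S - b - 2 * l)
  have hinj : Set.InjOn e (Finset.range ((S - b) / 2 + 1)) := by
    intro l _ l' _ h
    have := congrArg Prod.fst h
    simp only [e] at this
    omega
  have hE : (Finset.range ((S - b) / 2 + 1)).image e ⊆ Lam K \ (LamV2 K \ LamV2 S) := by
    intro μ hμ
    obtain ⟨l, hl, rfl⟩ := Finset.mem_image.1 hμ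
    have := Finset.mem_range.1 hl
    simp only [Finset.mem_sdiff, mem_Lam, mem_LamV2, e]
    omega
  rw [← Finset.sum_subset hE, Finset.sum_image hinj, harmPoly, Finset.mul_sum]
  · refine Finset.sum_congr rfl fun l hl => ?_
    have hl := Finset.mem_range.1 hl
    have hh : harmJet S b (b + 2 * l) (S - b - 2 * l) = (-1) ^ l := by
      rw [harmJet, if_pos ⟨by omega, by omega, by simp⟩]
      congr 1
      omega
    simp only [e]
    rw [hU _ _ (by omega), hh]
    ring
  · rintro ⟨i, j⟩ hμ hμ'
    have hz : U i j = 0 := by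
      rcases le_or_gt (i + j) S with hs | hs
      · rw [hU _ _ hs, harmJet, if_neg, mul_zero]
        rintro ⟨h2, h3, r, h4⟩
        refine hμ' (Finset.mem_image.2 ⟨r, ?_, ?_⟩)
        · rw [Finset.mem_range]
          omega
        · simp only [e, Prod.mk.injEq]
          omega
      · refine h1 i j ?_ hs
        simp only [Finset.mem_sdiff, mem_Lam, mem_LamV2] at hμ
        omega
    simp only [hz, zero_mul]

theorem taylorPoly_self_eq_harmPoly {S b : ℕ} (hb : b ≤ S) (c : ℝ)
    {U : ℕ → ℕ → ℝ} (hU : ∀ i j, i + j ≤ S → U i j = c * harmJet S b i j) (x y : ℝ) :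
    taylorPoly S U x y = c * harmPoly S b x y := by
  have e : taylorPoly S U x y = taylorPoly S (fun i j => c * harmJet S b i j) x y :=
    Finset.sum_congr rfl fun μ hμ => by rw [hU _ _ (mem_Lam.1 hμ)]
  rw [e, taylorPoly_eq_harmPoly_add hb le_rfl c (fun _ _ _ => rfl), Finset.sdiff_self,
    Finset.sum_empty, add_zero]
  intro i j _ h
  rw [harmJet, if_neg (by omega), mul_zero]

theorem GV_eq_taylorPoly {α : ℕ → ℕ → ℝ} (hα : α 0 0 ≠ 0) {M m n : ℕ} (hm : m ≤ 1)
    (hmn : m + n ≤ M + 1) (x y : ℝ) :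
    GV α M m n x y = taylorPoly (M + 1) (solJet α (unitJet m n) 0) x y := by
  rw [taylorPoly_eq_harmPoly_add (S := m + n) (b := m) (by omega) hmn 1
    (U := solJet α (unitJet m n) 0) fun i j hij => AVu_of_le hα hm hij]
  · simp only [GV, AVu, harmPoly, one_mul, Nat.add_sub_cancel_left]
  · intro i j hi hij
    rw [solJet_of_le_one _ _ _ hi, unitJet, if_neg (by omega)]

theorem QV_eq_taylorPoly {α : ℕ → ℕ → ℝ} (hα : α 0 0 ≠ 0) {M m n : ℕ}
    (hmn : m + n + 2 ≤ M + 1) (x y : ℝ) :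
    QV α M m n x y = taylorPoly (M + 1) (solJet α 0 (unitJet m n)) x y := by
  rw [taylorPoly_eq_harmPoly_add (S := m + n + 2) (b := m + 2) (by omega) hmn (-(α 0 0)⁻¹)
    (U := solJet α 0 (unitJet m n)) fun i j hij => AVf_of_le hα hij]
  · simp only [QV, AVf]
    congr 1
    have hI : Finset.Icc 1 (1 + n / 2) = Finset.Ico (0 + 1) (n / 2 + 1 + 1) := by
      ext l
      simp only [Finset.mem_Icc, Finset.mem_Ico]
      omega
    rw [hI, ← Finset.sum_Ico_add', harmPoly, Finset.mul_sum,
      show m + n + 2 - (m + 2) = n by omega, Finset.range_eq_Ico]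
    refine Finset.sum_congr rfl fun l _ => ?_
    rw [show m + 2 * (l + 1) = m + 2 + 2 * l by ring,
      show n + 2 - 2 * (l + 1) = n - 2 * l by omega, pow_succ]
    ring
  · intro i j hi hij
    rw [solJet_of_le_one _ _ _ hi]
    rfl

/-- The coefficient extraction `T(kh, ℓh) = h^S (H(k, ℓ) + o(1))` for a polynomial with leading
part `H` of degree `S`. -/
theorem tendsto_taylorPoly_div {K S : ℕ} (hS : S ≤ K) {U : ℕ → ℕ → ℝ}
    (hU : ∀ i j, i + j < S → U i j = 0) (x y : ℝ) :
    Tendsto (fun h => taylorPoly K U (x * h) (y * h) / h ^ S) (𝓝[>] 0)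
      (𝓝 (taylorPoly S U x y)) := by
  have e : taylorPoly S U x y = ∑ μ ∈ Lam K, if μ.1 + μ.2 = S then
      U μ.1 μ.2 * (x ^ μ.1 * y ^ μ.2 / (μ.1.factorial * μ.2.factorial)) else 0 := by
    rw [← Finset.sum_subset (s₁ := Lam S)]
    · refine Finset.sum_congr rfl fun μ hμ => ?_
      split_ifs with h
      · rfl
      · rw [hU _ _ (lt_of_le_of_ne (mem_Lam.1 hμ) h), zero_mul]
    · intro μ hμ
      exact mem_Lam.2 ((mem_Lam.1 hμ).trans hS)
    · intro μ _ hμ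
      exact if_neg fun h => hμ (mem_Lam.2 h.le)
  rw [e]
  simp only [taylorPoly, Finset.sum_div]
  refine tendsto_finsetSum _ fun μ _ => ?_
  split_ifs with h
  · refine tendsto_const_nhds.congr' ?_
    filter_upwards [self_mem_nhdsWithin] with t ht
    have ht : (0 : ℝ) < t := ht
    rw [mul_pow, mul_pow, ← h, pow_add]
    field_simp
  · rcases lt_or_gt_of_ne h with h | h
    · simp [hU _ _ h]
    · have h0 : Tendsto (fun t : ℝ => U μ.1 μ.2 * (x ^ μ.1 * y ^ μ.2 /
          (μ.1.factorial * μ.2.factorial)) * t ^ (μ.1 + μ.2 - S)) (𝓝[>] 0) (𝓝 0) := by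
        have : Tendsto (fun t : ℝ => U μ.1 μ.2 * (x ^ μ.1 * y ^ μ.2 /
          (μ.1.factorial * μ.2.factorial)) * t ^ (μ.1 + μ.2 - S)) (𝓝 0) (𝓝 0) :=
          Continuous.tendsto' (by fun_prop) _ _ (by simp [zero_pow (show μ.1 + μ.2 - S ≠ 0 by omega)])
        exact this.mono_left nhdsWithin_le_nhds
      refine h0.congr' ?_
      filter_upwards [self_mem_nhdsWithin] with t ht
      have ht : (0 : ℝ) < t := ht
      have e2 : t ^ μ.1 * t ^ μ.2 = t ^ (μ.1 + μ.2 - S) * t ^ S := by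
        rw [← pow_add, ← pow_add]
        congr 1
        omega
      rw [mul_pow, mul_pow, show x ^ μ.1 * t ^ μ.1 * (y ^ μ.2 * t ^ μ.2)
        = x ^ μ.1 * y ^ μ.2 * (t ^ μ.1 * t ^ μ.2) by ring, e2]
      field_simp

/-! ### Consistency of the schemes -/

theorem sum_stIdx (F : ℤ → ℝ) : ∑ k ∈ stIdx, F k = F (-1) + F 0 + F 1 := by
  have : stIdx = {-1, 0, 1} := by decide
  rw [this, Finset.sum_insert (by decide), Finset.sum_insert (by decide), Finset.sum_singleton]
  ring

theorem forall_stIdx {P : ℤ → Prop} : (∀ k ∈ stIdx, P k) ↔ P (-1) ∧ P 0 ∧ P 1 := by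
  have : stIdx = {-1, 0, 1} := by decide
  simp [this]

/-- The decomposition `jet_eq_sum` summed against monomials. It is an exact identity, so it adds no
error of its own. -/
theorem taylorPoly_eq_sum {α U φ : ℕ → ℕ → ℝ} (hα : α 0 0 ≠ 0) {M : ℕ}
    (heq : ∀ m n, m + n ≤ M → divGradJet α U m n = -φ m n) (x y : ℝ) :
    taylorPoly (M + 2) U x y = ∑ μ ∈ LamV1 (M + 2), U μ.1 μ.2 * GV α (M + 1) μ.1 μ.2 x y
      + ∑ μ ∈ Lam M, φ μ.1 μ.2 * QV α (M + 1) μ.1 μ.2 x y := by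
  have hG : ∀ μ ∈ LamV1 (M + 2), U μ.1 μ.2 * GV α (M + 1) μ.1 μ.2 x y = ∑ ν ∈ Lam (M + 2),
      U μ.1 μ.2 * AVu α ν.1 ν.2 μ.1 μ.2
        * (x ^ ν.1 * y ^ ν.2 / (ν.1.factorial * ν.2.factorial)) := by
    intro μ hμ
    rw [GV_eq_taylorPoly hα (mem_LamV1.1 hμ).2 (mem_LamV1.1 hμ).1, taylorPoly, Finset.mul_sum]
    simp only [AVu, mul_assoc]
  have hQ : ∀ μ ∈ Lam M, φ μ.1 μ.2 * QV α (M + 1) μ.1 μ.2 x y = ∑ ν ∈ Lam (M + 2),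
      φ μ.1 μ.2 * AVf α ν.1 ν.2 μ.1 μ.2
        * (x ^ ν.1 * y ^ ν.2 / (ν.1.factorial * ν.2.factorial)) := by
    intro μ hμ
    rw [QV_eq_taylorPoly hα (Nat.add_le_add_right (mem_Lam.1 hμ) 2), taylorPoly, Finset.mul_sum]
    simp only [AVf, mul_assoc]
  rw [Finset.sum_congr rfl hG, Finset.sum_congr rfl hQ, Finset.sum_comm,
    Finset.sum_comm (s := Lam M), ← Finset.sum_add_distrib, taylorPoly]
  refine Finset.sum_congr rfl fun ν hν => ?_
  rw [jet_eq_sum hα heq _ _ (mem_Lam.1 hν), add_mul, Finset.sum_mul, Finset.sum_mul]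

theorem continuous_polyCoeff (M : ℕ) (c : ℤ → ℤ → ℕ → ℝ) (k l : ℤ) :
    Continuous (polyCoeff M c k l) := by
  unfold polyCoeff
  fun_prop

theorem tendsto_polyCoeff (M : ℕ) (c : ℤ → ℤ → ℕ → ℝ) (k l : ℤ) :
    Tendsto (polyCoeff M c k l) (𝓝[>] 0) (𝓝 (c k l 0)) := by
  have h : polyCoeff M c k l 0 = c k l 0 := by
    simp [polyCoeff, Finset.sum_range_succ']
  exact h ▸ ((continuous_polyCoeff M c k l).tendsto 0).mono_left nhdsWithin_le_nhds

theorem isBigO_truncError {a u f : ℝ × ℝ → ℝ} {p : ℝ × ℝ} {M : ℕ}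
    (ha : ContDiffAt ℝ (M + 1 : ℕ) a p) (ha0 : a p ≠ 0) (hu : ContDiffAt ℝ (M + 2 : ℕ) u p)
    (hlip : ∀ m n, m + n = M + 2 →
      (fun q => pderiv m n u q - pderiv m n u p) =O[𝓝 p] fun q => q - p)
    (hf : ellip a u =ᶠ[𝓝 p] f) {c : ℤ → ℤ → ℕ → ℝ} (hc : SolvesSystem (jetAt a p) (M + 1) c) :
    truncError M (polyCoeff (M + 1) c) (rhsCoeff (jetAt a p) (M + 1) c) p u f
      =O[𝓝[>] 0] fun h : ℝ => h ^ (M + 3) := by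
  have heq : ∀ m n, m + n ≤ M →
      divGradJet (jetAt a p) (jetAt u p) m n = -pderiv m n f p := by
    intro m n hmn
    rw [← (pderiv_congr m n hf).eq_of_nhds, pderiv_ellip m n (ha.of_nat_le (by omega))
      (hu.of_nat_le (by omega)), neg_neg]
  -- Replacing `u` by its Taylor polynomial, the `Q` terms cancel the right-hand side of the scheme
  -- exactly; the remainders and the `G` terms are left.
  have key : ∀ h, truncError M (polyCoeff (M + 1) c) (rhsCoeff (jetAt a p) (M + 1) c) p u f h
      = (∑ k ∈ stIdx, ∑ l ∈ stIdx, polyCoeff (M + 1) c k l h * (u (p.1 + k * h, p.2 + l * h)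
          - taylorPoly (M + 2) (jetAt u p) (k * h) (l * h)))
        + ∑ μ ∈ LamV1 (M + 2), jetAt u p μ.1 μ.2 * ∑ k ∈ stIdx, ∑ l ∈ stIdx,
          polyCoeff (M + 1) c k l h * GV (jetAt a p) (M + 1) μ.1 μ.2 (k * h) (l * h) := by
    intro h
    have e : ∀ k l : ℤ, polyCoeff (M + 1) c k l h * (u (p.1 + k * h, p.2 + l * h)
          - taylorPoly (M + 2) (jetAt u p) (k * h) (l * h))
        = polyCoeff (M + 1) c k l h * u (stPt p h k l)
          - (∑ μ ∈ LamV1 (M + 2), jetAt u p μ.1 μ.2 *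
              (polyCoeff (M + 1) c k l h * GV (jetAt a p) (M + 1) μ.1 μ.2 (k * h) (l * h)))
          - ∑ μ ∈ Lam M, pderiv μ.1 μ.2 f p *
            (polyCoeff (M + 1) c k l h * QV (jetAt a p) (M + 1) μ.1 μ.2 (k * h) (l * h)) := by
      intro k l
      rw [taylorPoly_eq_sum (φ := fun m n => pderiv m n f p) ha0 heq, mul_sub, mul_add,
        Finset.mul_sum, Finset.mul_sum, sub_sub]
      simp only [mul_left_comm (polyCoeff _ _ _ _ _)]
      rfl
    simp only [e, Finset.sum_sub_distrib, truncError, stencilOp, rhsCoeff, Finset.mul_sum]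
    have sw : ∀ (s : Finset (ℕ × ℕ)) (F : ℤ → ℤ → ℕ × ℕ → ℝ),
        ∑ k ∈ stIdx, ∑ l ∈ stIdx, ∑ μ ∈ s, F k l μ
          = ∑ μ ∈ s, ∑ k ∈ stIdx, ∑ l ∈ stIdx, F k l μ := by
      intro s F
      rw [Finset.sum_congr rfl fun k _ => Finset.sum_comm, Finset.sum_comm]
    rw [sw, sw]
    ring
  refine (Asymptotics.IsBigO.congr_left ?_ fun h => (key h).symm)
  refine Asymptotics.IsBigO.add ?_ ?_
  · refine Asymptotics.IsBigO.fun_sum fun k _ => Asymptotics.IsBigO.fun_sum fun l _ => ?_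
    have h1 := (taylor_ray (M + 2) hu hlip k l).mono (nhdsWithin_le_nhds (s := Ioi 0))
    have h2 := (tendsto_polyCoeff (M + 1) c k l).isBigO_one ℝ
    simpa using h2.mul h1
  · exact Asymptotics.IsBigO.fun_sum fun μ hμ => (hc μ hμ).const_mul_left _

theorem jet_eq_zero_of_lt {c : ℝ} {S b : ℕ} {U : ℕ → ℕ → ℝ}
    (hU : ∀ i j, i + j ≤ S → U i j = c * harmJet S b i j) (i j : ℕ) (h : i + j < S) :
    U i j = 0 := by
  rw [hU i j h.le, harmJet_of_lt h, mul_zero]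

theorem tendsto_GV_div {α : ℕ → ℕ → ℝ} (hα : α 0 0 ≠ 0) {K m n : ℕ} (hm : m ≤ 1)
    (hmn : m + n ≤ K) (x y : ℝ) :
    Tendsto (fun h => taylorPoly K (solJet α (unitJet m n) 0) (x * h) (y * h) / h ^ (m + n))
      (𝓝[>] 0) (𝓝 (harmPoly (m + n) m x y)) := by
  have hU : ∀ i j, i + j ≤ m + n → solJet α (unitJet m n) 0 i j = 1 * harmJet (m + n) m i j :=
    fun i j hij => AVu_of_le hα hm hij
  have := tendsto_taylorPoly_div hmn (jet_eq_zero_of_lt hU) x y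
  rwa [taylorPoly_self_eq_harmPoly (by omega) 1 hU, one_mul] at this

theorem isLittleO_div_pow {F : ℝ → ℝ} {n S : ℕ} (hF : F =O[𝓝[>] 0] fun h => h ^ n)
    (hS : S < n) : Tendsto (fun h => F h / h ^ S) (𝓝[>] 0) (𝓝 0) := by
  have h1 : (fun h : ℝ => F h / h ^ S) =O[𝓝[>] 0] fun h => h ^ (n - S) := by
    have := hF.mul (Asymptotics.isBigO_refl (fun h : ℝ => (h ^ S)⁻¹) (𝓝[>] 0))
    refine (this.congr' (EventuallyEq.of_eq (funext fun h => by simp [div_eq_mul_inv])) ?_)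
    filter_upwards [self_mem_nhdsWithin] with t ht
    have ht : t ≠ 0 := ne_of_gt ht
    rw [pow_sub₀ t ht hS.le]
  refine h1.trans_tendsto ?_
  have : Tendsto (fun h : ℝ => h ^ (n - S)) (𝓝 0) (𝓝 0) :=
    Continuous.tendsto' (by fun_prop) _ _ (zero_pow (by omega))
  exact this.mono_left nhdsWithin_le_nhds

/-- The leading coefficients of a solution of the order-matching system annihilate the harmonic
polynomials. -/
theorem sum_coeff_mul_harmPoly {α : ℕ → ℕ → ℝ} (hα : α 0 0 ≠ 0) {M : ℕ} {c : ℤ → ℤ → ℕ → ℝ}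
    (hc : SolvesSystem α M c) {m n : ℕ} (hm : m ≤ 1) (hmn : m + n ≤ M + 1) :
    ∑ k ∈ stIdx, ∑ l ∈ stIdx, c k l 0 * harmPoly (m + n) m k l = 0 := by
  have h0 := isLittleO_div_pow (S := m + n) (hc (m, n) (mem_LamV1.2 ⟨hmn, hm⟩)) (by omega)
  refine tendsto_nhds_unique ?_ h0
  simp only [Finset.sum_div, mul_div_assoc, GV_eq_taylorPoly hα hm hmn]
  exact tendsto_finsetSum _ fun k _ => tendsto_finsetSum _ fun l _ =>
    (tendsto_polyCoeff M c k l).mul (tendsto_GV_div hα hm hmn k l)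

/-- The values of the harmonic polynomials of degree at most four, and of one more function, on
the nine points determine a weight on them. -/
theorem coeff_eq_zero {x : ℤ → ℤ → ℝ} (h : ∀ m n, m ≤ 1 → m + n ≤ 4 →
      ∑ k ∈ stIdx, ∑ l ∈ stIdx, x k l * harmPoly (m + n) m k l = 0)
    (h2 : ∑ k ∈ stIdx, ∑ l ∈ stIdx, x k l * (k : ℝ) ^ 2 = 0) :
    ∀ k ∈ stIdx, ∀ l ∈ stIdx, x k l = 0 := by
  -- Eight conditions suffice: the remaining index `(1, 3)` gives a multiple of `xy³ - x³y`, which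
  -- vanishes at all nine points.
  have e00 := h 0 0 (by norm_num) (by norm_num)
  have e01 := h 0 1 (by norm_num) (by norm_num)
  have e10 := h 1 0 (by norm_num) (by norm_num)
  have e02 := h 0 2 (by norm_num) (by norm_num)
  have e11 := h 1 1 (by norm_num) (by norm_num)
  have e03 := h 0 3 (by norm_num) (by norm_num)
  have e12 := h 1 2 (by norm_num) (by norm_num)
  have e04 := h 0 4 (by norm_num) (by norm_num)
  simp [sum_stIdx, harmPoly, Finset.sum_range_succ, Nat.factorial] at e00 e01 e10 e02 e11 e03 e12 e04 h2
  simp only [forall_stIdx]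
  refine ⟨⟨?_, ?_, ?_⟩, ⟨?_, ?_, ?_⟩, ⟨?_, ?_, ?_⟩⟩ <;> linarith

/-- A quantitative inverse for nine harmonic polynomials. On the nine points degrees 5 to 7 give
nothing new, while in degree 8 the axis points and the corners have values in the ratio `1 : 16`
instead of the `1 : -4` of degree 4. The constant is crude and absorbs factorials up to `8!`. -/
theorem abs_coeff_le {x : ℤ → ℤ → ℝ} {δ : ℝ} (h : ∀ m n, m ≤ 1 → m + n ≤ 8 →
      |∑ k ∈ stIdx, ∑ l ∈ stIdx, x k l * harmPoly (m + n) m k l| ≤ δ) :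
    ∀ k ∈ stIdx, ∀ l ∈ stIdx, |x k l| ≤ 10 ^ 6 * δ := by
  have e00 := h 0 0 (by norm_num) (by norm_num)
  have e01 := h 0 1 (by norm_num) (by norm_num)
  have e10 := h 1 0 (by norm_num) (by norm_num)
  have e02 := h 0 2 (by norm_num) (by norm_num)
  have e11 := h 1 1 (by norm_num) (by norm_num)
  have e03 := h 0 3 (by norm_num) (by norm_num)
  have e12 := h 1 2 (by norm_num) (by norm_num)
  have e04 := h 0 4 (by norm_num) (by norm_num)
  have e08 := h 0 8 (by norm_num) (by norm_num)
  simp [sum_stIdx, harmPoly, Finset.sum_range_succ, Nat.factorial, abs_le] at e00 e01 e10 e02 e11 e03 e12 e04 e08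
  ring_nf at e00 e01 e10 e02 e11 e03 e12 e04 e08
  simp only [forall_stIdx, abs_le]
  refine ⟨⟨?_, ?_, ?_⟩, ⟨?_, ?_, ?_⟩, ⟨?_, ?_, ?_⟩⟩ <;> constructor <;> linarith

/-- The limit of `h⁻² C_{f,0,0}(h)`. -/
noncomputable def leadRhs (α : ℕ → ℕ → ℝ) (c : ℤ → ℤ → ℕ → ℝ) : ℝ :=
  ∑ k ∈ stIdx, ∑ l ∈ stIdx, c k l 0 * (-(α 0 0)⁻¹ * harmPoly 2 2 k l)

/-- If the limit vanished, the leading weights would annihilate `x²` besides the harmonic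
polynomials of degree at most `4 ≤ M + 1`, hence vanish by `coeff_eq_zero`. -/
theorem leadRhs_ne_zero {α : ℕ → ℕ → ℝ} (hα : α 0 0 ≠ 0) {M : ℕ} (hM : 3 ≤ M)
    {c : ℤ → ℤ → ℕ → ℝ} (hc : SolvesSystem α M c) (hnt : Nontriv c) : leadRhs α c ≠ 0 := by
  intro h0
  obtain ⟨k, hk, l, hl, hkl⟩ := hnt
  refine hkl (coeff_eq_zero (x := fun k l => c k l 0)
    (fun m n hm hmn => sum_coeff_mul_harmPoly hα hc hm (by omega)) ?_ k hk l hl)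
  have e : leadRhs α c = -(2 * α 0 0)⁻¹ * ∑ k ∈ stIdx, ∑ l ∈ stIdx, c k l 0 * (k : ℝ) ^ 2 := by
    simp only [leadRhs, Finset.mul_sum]
    refine Finset.sum_congr rfl fun k _ => Finset.sum_congr rfl fun l _ => ?_
    simp [harmPoly]
    ring
  rw [e] at h0
  exact (mul_eq_zero.1 h0).resolve_left (by simpa using hα)

theorem tendsto_rhsCoeff_div {α : ℕ → ℕ → ℝ} (hα : α 0 0 ≠ 0) {M m n : ℕ}
    (hmn : m + n + 2 ≤ M + 1) (c : ℤ → ℤ → ℕ → ℝ) :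
    Tendsto (fun h => rhsCoeff α M c m n h / h ^ 2) (𝓝[>] 0)
      (𝓝 (if m + n = 0 then leadRhs α c else 0)) := by
  have hU : ∀ i j, i + j ≤ m + n + 2 →
      solJet α 0 (unitJet m n) i j = -(α 0 0)⁻¹ * harmJet (m + n + 2) (m + 2) i j :=
    fun i j hij => AVf_of_le hα hij
  have hlim : ∀ k l : ℝ, taylorPoly 2 (solJet α 0 (unitJet m n)) k l
      = if m + n = 0 then -(α 0 0)⁻¹ * harmPoly 2 2 k l else 0 := by
    intro k l
    split_ifs with h
    · obtain ⟨rfl, rfl⟩ : m = 0 ∧ n = 0 := by omega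
      exact taylorPoly_self_eq_harmPoly le_rfl _ hU k l
    · refine Finset.sum_eq_zero fun μ hμ => ?_
      rw [jet_eq_zero_of_lt hU _ _ (by have := mem_Lam.1 hμ; omega), zero_mul]
  have main : Tendsto (fun h => rhsCoeff α M c m n h / h ^ 2) (𝓝[>] 0)
      (𝓝 (∑ k ∈ stIdx, ∑ l ∈ stIdx,
        c k l 0 * (if m + n = 0 then -(α 0 0)⁻¹ * harmPoly 2 2 k l else 0))) := by
    simp only [rhsCoeff, Finset.sum_div, mul_div_assoc, QV_eq_taylorPoly hα hmn, ← hlim]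
    exact tendsto_finsetSum _ fun k _ => tendsto_finsetSum _ fun l _ =>
      (tendsto_polyCoeff M c k l).mul (tendsto_taylorPoly_div (by omega)
        (fun i j hij => jet_eq_zero_of_lt hU i j (by omega)) k l)
  split_ifs with h
  · simpa only [if_pos h, leadRhs] using main
  · simpa only [if_neg h, mul_zero, Finset.sum_const_zero] using main

/-- The truncation error is `o(h²)`, and on the right-hand side only the coefficient of `f` itself
survives division by `h²`. -/
theorem tendsto_stencilOp_div {α : ℕ → ℕ → ℝ} (hα : α 0 0 ≠ 0) {M : ℕ} {c : ℤ → ℤ → ℕ → ℝ}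
    {p : ℝ × ℝ} {u f : ℝ × ℝ → ℝ}
    (ht : truncError M (polyCoeff (M + 1) c) (rhsCoeff α (M + 1) c) p u f
      =O[𝓝[>] 0] fun h : ℝ => h ^ (M + 3)) :
    Tendsto (fun h : ℝ => stencilOp (polyCoeff (M + 1) c) p u h / h ^ 2) (𝓝[>] 0)
      (𝓝 (leadRhs α c * f p)) := by
  have h1 := isLittleO_div_pow (S := 2) ht (by omega)
  have h2 : Tendsto (fun h => ∑ μ ∈ Lam M, pderiv μ.1 μ.2 f p *
      (rhsCoeff α (M + 1) c μ.1 μ.2 h / h ^ 2)) (𝓝[>] 0) (𝓝 (∑ μ ∈ Lam M, pderiv μ.1 μ.2 f p *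
        if μ.1 + μ.2 = 0 then leadRhs α c else 0)) :=
    tendsto_finsetSum _ fun μ hμ => (tendsto_rhsCoeff_div hα
      (by have := mem_Lam.1 hμ; omega) c).const_mul _
  have h3 : ∑ μ ∈ Lam M, pderiv μ.1 μ.2 f p * (if μ.1 + μ.2 = 0 then leadRhs α c else 0)
      = leadRhs α c * f p := by
    rw [Finset.sum_eq_single_of_mem (0, 0) (mem_Lam.2 (Nat.zero_le M))]
    · exact (congrArg _ (if_pos rfl)).trans (mul_comm _ _)
    · rintro ⟨i, j⟩ _ hne
      rw [if_neg, mul_zero]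
      intro h
      obtain ⟨rfl, rfl⟩ : i = 0 ∧ j = 0 := by simpa using h
      exact hne rfl
  rw [← h3, ← zero_add (Finset.sum _ _)]
  refine (h1.add h2).congr fun h => ?_
  simp only [truncError, mul_div_assoc', ← Finset.sum_div]
  ring

/-! ### The bound on the accuracy order -/

/-- The `C k l` are not known to be bounded, so one cannot simply replace `T` by its limit. Instead
the replacement error is a small multiple of the sum `s` of their absolute values, which is absorbed
by means of `abs_coeff_le`. -/
theorem tendsto_zero_of_near_unisolvent {C : ℤ → ℤ → ℝ → ℝ} {T : ℕ → ℕ → ℝ → ℝ → ℝ → ℝ}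
    (hT : ∀ m n, m ≤ 1 → m + n ≤ 8 → ∀ k l : ℝ,
      Tendsto (T m n k l) (𝓝[>] 0) (𝓝 (harmPoly (m + n) m k l)))
    (hC : ∀ m n, m ≤ 1 → m + n ≤ 8 → Tendsto
      (fun h => ∑ k ∈ stIdx, ∑ l ∈ stIdx, C k l h * T m n k l h) (𝓝[>] 0) (𝓝 0)) :
    ∀ k ∈ stIdx, ∀ l ∈ stIdx, Tendsto (C k l) (𝓝[>] 0) (𝓝 0) := by
  have hcard : stIdx.card = 3 := rfl
  intro k hk l hl
  rw [Metric.tendsto_nhds]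
  intro ε hε
  have hfin : ∀ᶠ h in 𝓝[>] (0 : ℝ), ∀ μ ∈ LamV1 8,
      |∑ k ∈ stIdx, ∑ l ∈ stIdx, C k l h * T μ.1 μ.2 k l h| < ε / 10 ^ 8 ∧
      ∀ k ∈ stIdx, ∀ l ∈ stIdx,
        |T μ.1 μ.2 k l h - harmPoly (μ.1 + μ.2) μ.1 k l| < 1 / 10 ^ 8 := by
    rw [Filter.eventually_all_finset]
    intro μ hμ
    obtain ⟨h8, h1⟩ := mem_LamV1.1 hμ
    refine Filter.Eventually.and ?_ ?_
    · have := (Metric.tendsto_nhds.1 (hC μ.1 μ.2 h1 h8)) (ε / 10 ^ 8) (by positivity)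
      simpa [Real.dist_eq] using this
    · rw [Filter.eventually_all_finset]
      intro k _
      rw [Filter.eventually_all_finset]
      intro l _
      have := (Metric.tendsto_nhds.1 (hT μ.1 μ.2 h1 h8 k l)) (1 / 10 ^ 8) (by positivity)
      simpa [Real.dist_eq] using this
  filter_upwards [hfin] with h hh
  set s := ∑ k ∈ stIdx, ∑ l ∈ stIdx, |C k l h| with hs
  have hδ : ∀ m n, m ≤ 1 → m + n ≤ 8 →
      |∑ k ∈ stIdx, ∑ l ∈ stIdx, C k l h * harmPoly (m + n) m k l|
        ≤ ε / 10 ^ 8 + s / 10 ^ 8 := by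
    intro m n hm hmn
    obtain ⟨h1, h2⟩ := hh (m, n) (mem_LamV1.2 ⟨hmn, hm⟩)
    have e : ∑ k ∈ stIdx, ∑ l ∈ stIdx, C k l h * harmPoly (m + n) m k l
        = ∑ k ∈ stIdx, ∑ l ∈ stIdx, C k l h * T m n k l h
          - ∑ k ∈ stIdx, ∑ l ∈ stIdx, C k l h * (T m n k l h - harmPoly (m + n) m k l) := by
      simp only [mul_sub, Finset.sum_sub_distrib]
      ring
    have h3 : |∑ k ∈ stIdx, ∑ l ∈ stIdx, C k l h * (T m n k l h - harmPoly (m + n) m k l)|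
        ≤ s / 10 ^ 8 := by
      rw [hs, Finset.sum_div]
      refine (Finset.abs_sum_le_sum_abs _ _).trans (Finset.sum_le_sum fun k hk => ?_)
      rw [Finset.sum_div]
      refine (Finset.abs_sum_le_sum_abs _ _).trans (Finset.sum_le_sum fun l hl => ?_)
      rw [abs_mul, div_eq_mul_one_div]
      exact mul_le_mul_of_nonneg_left (h2 k hk l hl).le (abs_nonneg _)
    rw [e]
    exact (abs_sub _ _).trans (add_le_add h1.le h3)
  have hb := abs_coeff_le (x := fun k l => C k l h) hδ
  -- Nine weights with the constant `10 ^ 6` against the tolerance `10 ^ (-8)` give `s` the factor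
  -- `9 / 100` on the right, so `s` is bounded by a fraction of `ε`.
  have hs2 : s ≤ 9 * (10 ^ 6 * (ε / 10 ^ 8 + s / 10 ^ 8)) := by
    have : s ≤ ∑ k ∈ stIdx, ∑ l ∈ stIdx, 10 ^ 6 * (ε / 10 ^ 8 + s / 10 ^ 8) :=
      Finset.sum_le_sum fun k hk => Finset.sum_le_sum fun l hl => hb k hk l hl
    simp only [Finset.sum_const, hcard, nsmul_eq_mul] at this
    push_cast at this
    linarith
  have := hb k hk l hl
  rw [Real.dist_eq, sub_zero]
  linarith

/-- The test functions are polynomials whose jets solve the homogeneous equation, so the derivatives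
of `f` up to order `N` vanish at `p` and the arbitrary `F` play no role. For `q ≥ 7` the error is
`O(h⁹)`, which still tends to `0` after division by `h^(m+n)` with `m + n ≤ 8`. -/
theorem order_le_six {a : ℝ × ℝ → ℝ} {p : ℝ × ℝ} (ha0 : a p ≠ 0) {N q : ℕ}
    {C : ℤ → ℤ → ℝ → ℝ} {F : ℕ → ℕ → ℝ → ℝ} (ha : ContDiffAt ℝ ((N + 1 : ℕ) : WithTop ℕ∞) a p)
    (h : HasAccuracyOrder a p N C F q) : q ≤ 6 := by
  by_contra hq
  have hα : jetAt a p 0 0 ≠ 0 := ha0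
  let J : ℕ → ℕ → ℕ → ℕ → ℝ := fun m n => solJet (jetAt a p) (unitJet m n) 0
  refine h.1 (tendsto_zero_of_near_unisolvent (T := fun m n k l h =>
    taylorPoly (N + 10) (J m n) (k * h) (l * h) / h ^ (m + n)) ?_ ?_)
  · intro m n hm hmn k l
    exact tendsto_GV_div hα hm (by omega) k l
  · intro m n hm hmn
    -- Degree `N + 10` covers both the order `N + 2` entering the derivatives of `f` and the degree
    -- 8 of the harmonic test polynomials.
    have h1 := h.2 (polyAt (N + 10) (J m n) p) (contDiff_polyAt _ _ _)
    refine (isLittleO_div_pow (S := m + n) h1 (by omega)).congr fun t => ?_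
    have hz : ∑ μ ∈ Lam N, pderiv μ.1 μ.2 (ellip a (polyAt (N + 10) (J m n) p)) p * F μ.1 μ.2 t
        = 0 := by
      refine Finset.sum_eq_zero fun μ hμ => ?_
      have hμ := mem_Lam.1 hμ
      rw [pderiv_ellip _ _ (ha.of_nat_le (by omega)) (contDiff_polyAt _ _ _).contDiffAt,
        divGradJet_congr (β := jetAt a p) (V := J m n) (fun _ _ _ => rfl)
          (fun i j hij => jetAt_polyAt (by omega) _ _), divGradJet_solJet hα]
      simp
    rw [truncError, hz, sub_zero, stencilOp]
    simp only [Finset.sum_div, mul_div_assoc, polyAt, stPt, add_sub_cancel_left]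

/-! ### Regular points -/

theorem eventually_stPt_mem {p : ℝ × ℝ} {s : Set (ℝ × ℝ)} (hs : s ∈ 𝓝 p) :
    ∀ᶠ h in 𝓝[>] (0 : ℝ), ∀ k ∈ stIdx, ∀ l ∈ stIdx, stPt p h k l ∈ s := by
  rw [Filter.eventually_all_finset]
  intro k _
  rw [Filter.eventually_all_finset]
  intro l _
  exact ((tendsto_ray p k l).mono_left nhdsWithin_le_nhds).eventually hs

theorem isOpen_rect (l₁ l₂ l₃ l₄ : ℝ) : IsOpen (rect l₁ l₂ l₃ l₄) :=
  isOpen_Ioo.prod isOpen_Ioo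

theorem mem_nhds_omega {Ω : Set (ℝ × ℝ)} (hΩ : IsOpen Ω) {ψ : ℝ × ℝ → ℝ}
    (hψ : ContinuousOn ψ Ω) {p : ℝ × ℝ} (hp : p ∈ Ω \ interface Ω ψ) :
    omegaPlus Ω ψ ∈ 𝓝 p ∨ omegaMinus Ω ψ ∈ 𝓝 p := by
  have hn := hΩ.mem_nhds hp.1
  have hc := hψ.continuousAt hn
  rcases lt_trichotomy (ψ p) 0 with h | h | h
  · exact Or.inr (inter_mem hn (hc.eventually (gt_mem_nhds h)))
  · exact absurd ⟨hp.1, h⟩ hp.2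
  · exact Or.inl (inter_mem hn (hc.eventually (lt_mem_nhds h)))

theorem eventually_isRegularPoint {Ω : Set (ℝ × ℝ)} {ψ : ℝ × ℝ → ℝ} {p : ℝ × ℝ}
    (h : omegaPlus Ω ψ ∈ 𝓝 p ∨ omegaMinus Ω ψ ∈ 𝓝 p) :
    ∀ᶠ h in 𝓝[>] (0 : ℝ), IsRegularPoint ψ p h := by
  rcases h with h | h
  · filter_upwards [eventually_stPt_mem h] with t ht
    refine Or.inr (Set.eq_empty_of_forall_notMem fun κ hκ => ?_)
    exact lt_asymm (ht _ hκ.1 _ hκ.2.1).2 hκ.2.2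
  · filter_upwards [eventually_stPt_mem h] with t ht
    refine Or.inl (Set.eq_empty_of_forall_notMem fun κ hκ => ?_)
    exact absurd hκ.2.2 (not_le.2 (ht _ hκ.1 _ hκ.2.1).2)

theorem isBigO_sub_of_locallyLipschitzOn {g : ℝ × ℝ → ℝ} {s : Set (ℝ × ℝ)} {p : ℝ × ℝ}
    (hs : s ∈ 𝓝 p) (hg : LocallyLipschitzOn s g) :
    (fun q => g q - g p) =O[𝓝 p] fun q => q - p := by
  obtain ⟨K, t, ht, hK⟩ := hg (mem_of_mem_nhds hs)
  rw [nhdsWithin_eq_nhds.2 hs] at ht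
  refine Asymptotics.IsBigO.of_bound K ?_
  filter_upwards [ht] with q hq
  exact hK.norm_sub_le hq (mem_of_mem_nhds ht)

/-- A solution is regular at the points off the interface. -/
theorem IsSolution.local {Ω : Set (ℝ × ℝ)} {ψ a u f : ℝ × ℝ → ℝ} {p : ℝ × ℝ}
    (hu : IsSolution Ω ψ a u f) (h : omegaPlus Ω ψ ∈ 𝓝 p ∨ omegaMinus Ω ψ ∈ 𝓝 p) :
    ContDiffAt ℝ (7 : ℕ) u p ∧ (∀ m n, m + n = 7 →
      (fun q => pderiv m n u q - pderiv m n u p) =O[𝓝 p] fun q => q - p) ∧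
    ellip a u =ᶠ[𝓝 p] f := by
  rcases h with h | h
  · refine ⟨hu.smooth_plus.contDiffAt h,
      fun m n hmn => isBigO_sub_of_locallyLipschitzOn h (hu.lip_plus m n hmn), ?_⟩
    filter_upwards [h] with q hq using hu.pde q ⟨hq.1, fun hc => hq.2.ne' hc.2⟩
  · refine ⟨hu.smooth_minus.contDiffAt h,
      fun m n hmn => isBigO_sub_of_locallyLipschitzOn h (hu.lip_minus m n hmn), ?_⟩
    filter_upwards [h] with q hq using hu.pde q ⟨hq.1, fun hc => hq.2.ne hc.2⟩

theorem IsCoefficient.local {Ω : Set (ℝ × ℝ)} {ψ a : ℝ × ℝ → ℝ} {p : ℝ × ℝ}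
    (ha : IsCoefficient Ω ψ a) (h : omegaPlus Ω ψ ∈ 𝓝 p ∨ omegaMinus Ω ψ ∈ 𝓝 p) :
    ContDiffAt ℝ (6 : ℕ) a p ∧ 0 < a p := by
  rcases h with h | h
  · exact ⟨ha.smooth_plus.contDiffAt h, ha.pos_plus p (mem_of_mem_nhds h)⟩
  · exact ⟨ha.smooth_minus.contDiffAt h, ha.pos_minus p (mem_of_mem_nhds h)⟩

theorem hasAccuracyOrder_six {a : ℝ × ℝ → ℝ} {p : ℝ × ℝ} (ha : ContDiffAt ℝ (6 : ℕ) a p)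
    (ha0 : a p ≠ 0) {c : ℤ → ℤ → ℕ → ℝ} (hnt : Nontriv c) (hc : SolvesSystem (jetAt a p) 6 c) :
    HasAccuracyOrder a p 5 (polyCoeff 6 c) (rhsCoeff (jetAt a p) 6 c) 6 := by
  constructor
  · intro h
    obtain ⟨k, hk, l, hl, hkl⟩ := hnt
    exact hkl (tendsto_nhds_unique (tendsto_polyCoeff 6 c k l) (h k hk l hl))
  · intro u hu
    have hu' : ∀ n : ℕ, ContDiffAt ℝ n u p := fun n => (contDiff_infty.1 hu n).contDiffAt
    exact isBigO_truncError ha ha0 (hu' 7) (fun m n _ =>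
      isBigO_sub_of_contDiffAt (contDiffAt_pderiv m n (hu' _))) EventuallyEq.rfl hc

/-! ### A compact sixth-order scheme for `Δv = qv` -/

/-- The left-hand side of the compact sixth-order scheme for `Δv = qv`, where `q` is given by its
jet, `s` is the nine-point Laplacian `6h²Δv + O(h⁴)`, `e` the value at the centre, and
`dx, dy, dxx, …` are the undivided central differences of `v`. -/
noncomputable def schrodingerForm (q : ℕ → ℕ → ℝ) (h s e dx dy dxx dyy dxy dxyy dxxy dxxyy : ℝ) :
    ℝ :=
  s - 6 * h ^ 2 * q 0 0 * e
    - 1 / 2 * ((q 2 0 + q 0 2 + q 0 0 ^ 2) * h ^ 4 * e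
      + 2 * q 1 0 * (h ^ 3 * dx
        - (h ^ 6 * q 1 0 * e + h ^ 5 * q 0 0 * dx - h ^ 3 * dxyy) / 6)
      + 2 * q 0 1 * (h ^ 3 * dy
        - (h ^ 6 * q 0 1 * e + h ^ 5 * q 0 0 * dy - h ^ 3 * dxxy) / 6))
    - 1 / 60 * (h ^ 6 * (q 4 0 + 4 * q 2 2 + q 0 4) * e
      + h ^ 5 * (4 * q 3 0 + 8 * q 1 2) * dx + h ^ 5 * (4 * q 0 3 + 8 * q 2 1) * dy
      + h ^ 4 * (6 * q 2 0 + 4 * q 0 2) * dxx + h ^ 4 * (6 * q 0 2 + 4 * q 2 0) * dyy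
      + 16 * h ^ 4 * q 1 1 * dxy
      + 4 * q 1 0 * (h ^ 6 * q 1 0 * e + h ^ 5 * q 0 0 * dx - h ^ 3 * dxyy)
      + 4 * q 0 1 * (h ^ 6 * q 0 1 * e + h ^ 5 * q 0 0 * dy - h ^ 3 * dxxy)
      + 8 * h ^ 3 * (q 1 0 * dxyy + q 0 1 * dxxy)
      + q 0 0 * (2 * h ^ 2 * dxxyy + h ^ 6 * (q 2 0 + q 0 2 + q 0 0 ^ 2) * e
        + 2 * h ^ 5 * (q 1 0 * dx + q 0 1 * dy)))

/-- The coefficients of the scheme for `Δv = qv`. -/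
noncomputable def schrodingerCoeff (q : ℕ → ℕ → ℝ) (k l : ℤ) (h : ℝ) : ℝ :=
  schrodingerForm q h (-20 + 24 * (k ^ 2 + l ^ 2) - 27 * k ^ 2 * l ^ 2)
    ((1 - k ^ 2) * (1 - l ^ 2)) (k / 2 * (1 - l ^ 2)) (l / 2 * (1 - k ^ 2))
    ((3 * k ^ 2 - 2) * (1 - l ^ 2)) ((3 * l ^ 2 - 2) * (1 - k ^ 2)) (k * l / 4)
    (k / 2 * (3 * l ^ 2 - 2)) (l / 2 * (3 * k ^ 2 - 2)) ((3 * k ^ 2 - 2) * (3 * l ^ 2 - 2))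

/-- `schrodingerForm` is linear in its difference arguments, and the polynomials in `k, l` in
`schrodingerCoeff` interpolate the stencil weights of these differences on `{-1, 0, 1}²`. -/
theorem sum_schrodingerCoeff (q : ℕ → ℕ → ℝ) (h : ℝ) (F : ℤ → ℤ → ℝ) :
    ∑ k ∈ stIdx, ∑ l ∈ stIdx, schrodingerCoeff q k l h * F k l
      = schrodingerForm q h
        (F 1 1 + F 1 (-1) + F (-1) 1 + F (-1) (-1)
          + 4 * (F 1 0 + F (-1) 0 + F 0 1 + F 0 (-1)) - 20 * F 0 0)
        (F 0 0) ((F 1 0 - F (-1) 0) / 2) ((F 0 1 - F 0 (-1)) / 2)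
        (F 1 0 + F (-1) 0 - 2 * F 0 0) (F 0 1 + F 0 (-1) - 2 * F 0 0)
        ((F 1 1 - F 1 (-1) - F (-1) 1 + F (-1) (-1)) / 4)
        ((F 1 1 + F 1 (-1) - 2 * F 1 0 - F (-1) 1 - F (-1) (-1) + 2 * F (-1) 0) / 2)
        ((F 1 1 + F (-1) 1 - 2 * F 0 1 - F 1 (-1) - F (-1) (-1) + 2 * F 0 (-1)) / 2)
        (F 1 1 + F 1 (-1) + F (-1) 1 + F (-1) (-1)
          - 2 * (F 1 0 + F (-1) 0 + F 0 1 + F 0 (-1)) + 4 * F 0 0) := by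
  simp only [sum_stIdx, schrodingerCoeff, schrodingerForm]
  push_cast
  ring

/-- The nine-point Laplacian is `6h²Δv + (h⁴/2)Δ²v + (h⁶/60)(∂_x⁴ + 4∂_x²∂_y² + ∂_y⁴)Δv + O(h⁸)`.
Substituting `Δv = qv` leaves derivatives of `v` that compact differences reach: third derivatives
in one variable are replaced by `v_xxx = (qv)_x - v_xyy` and its analogue, and fourth ones through
`Δ²v = Δ(qv)`. The parameters `tx, …` are the remainders of the differences, and each of them ends
up with a factor `h⁸`. -/
theorem schrodingerForm_eq {q V : ℕ → ℕ → ℝ}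
    (hV : ∀ i j, i + j ≤ 5 → V (i + 2) j + V i (j + 2) = leib q V i j)
    (h tx ty txx tyy txy txyy txxy txxyy : ℝ) :
    schrodingerForm q h
      (6 * h ^ 2 * (V 2 0 + V 0 2) + h ^ 4 / 2 * (V 4 0 + 2 * V 2 2 + V 0 4)
        + h ^ 6 / 60 * (V 6 0 + 5 * V 4 2 + 5 * V 2 4 + V 0 6))
      (V 0 0) (h * V 1 0 + h ^ 3 / 6 * V 3 0 + h ^ 5 * tx)
      (h * V 0 1 + h ^ 3 / 6 * V 0 3 + h ^ 5 * ty)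
      (h ^ 2 * V 2 0 + h ^ 4 * txx) (h ^ 2 * V 0 2 + h ^ 4 * tyy) (h ^ 2 * V 1 1 + h ^ 4 * txy)
      (h ^ 3 * V 1 2 + h ^ 5 * txyy) (h ^ 3 * V 2 1 + h ^ 5 * txxy)
      (h ^ 4 * V 2 2 + h ^ 6 * txxyy)
    = h ^ 8 * (-(q 1 0 * (tx - (q 0 0 * (V 3 0 / 6 + h ^ 2 * tx) - txyy) / 6)
        + q 0 1 * (ty - (q 0 0 * (V 0 3 / 6 + h ^ 2 * ty) - txxy) / 6))
      - 1 / 60 * ((4 * q 3 0 + 8 * q 1 2) * (V 3 0 / 6 + h ^ 2 * tx)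
        + (4 * q 0 3 + 8 * q 2 1) * (V 0 3 / 6 + h ^ 2 * ty)
        + (6 * q 2 0 + 4 * q 0 2) * txx + (6 * q 0 2 + 4 * q 2 0) * tyy + 16 * q 1 1 * txy
        + 4 * q 1 0 * (q 0 0 * (V 3 0 / 6 + h ^ 2 * tx) - txyy)
        + 4 * q 0 1 * (q 0 0 * (V 0 3 / 6 + h ^ 2 * ty) - txxy)
        + 8 * (q 1 0 * txyy + q 0 1 * txxy)
        + q 0 0 * (2 * txxyy + 2 * q 1 0 * (V 3 0 / 6 + h ^ 2 * tx)
          + 2 * q 0 1 * (V 0 3 / 6 + h ^ 2 * ty)))) := by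
  have r00 := hV 0 0 (by norm_num)
  have r10 := hV 1 0 (by norm_num)
  have r01 := hV 0 1 (by norm_num)
  have r20 := hV 2 0 (by norm_num)
  have r02 := hV 0 2 (by norm_num)
  have r40 := hV 4 0 (by norm_num)
  have r22 := hV 2 2 (by norm_num)
  have r04 := hV 0 4 (by norm_num)
  have c42 : Nat.choose 4 2 = 6 := rfl
  simp [leib, Finset.sum_range_succ, c42] at r00 r10 r01 r20 r02 r40 r22 r04
  rw [schrodingerForm]
  -- The weights follow the expansion of the nine-point Laplacian. The `1 / 10` is `1 / 6 - 1 / 15`,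
  -- from the two places where `v_xxx` and `v_yyy` are eliminated.
  linear_combination 6 * h ^ 2 * r00 + h ^ 4 / 2 * (r20 + r02 + q 0 0 * r00)
    + h ^ 6 / 60 * (r40 + 4 * r22 + r04 + q 0 0 * (r20 + r02 + q 0 0 * r00))
    - h ^ 6 / 10 * (q 1 0 * r10 + q 0 1 * r01)

theorem taylorPoly_seven (V : ℕ → ℕ → ℝ) (x y : ℝ) : taylorPoly 7 V x y =
    V 0 0 + V 1 0 * x + V 0 1 * y + V 2 0 * x ^ 2 / 2 + V 1 1 * x * y + V 0 2 * y ^ 2 / 2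
    + V 3 0 * x ^ 3 / 6 + V 2 1 * x ^ 2 * y / 2 + V 1 2 * x * y ^ 2 / 2 + V 0 3 * y ^ 3 / 6
    + V 4 0 * x ^ 4 / 24 + V 3 1 * x ^ 3 * y / 6 + V 2 2 * x ^ 2 * y ^ 2 / 4
    + V 1 3 * x * y ^ 3 / 6 + V 0 4 * y ^ 4 / 24
    + V 5 0 * x ^ 5 / 120 + V 4 1 * x ^ 4 * y / 24 + V 3 2 * x ^ 3 * y ^ 2 / 12
    + V 2 3 * x ^ 2 * y ^ 3 / 12 + V 1 4 * x * y ^ 4 / 24 + V 0 5 * y ^ 5 / 120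
    + V 6 0 * x ^ 6 / 720 + V 5 1 * x ^ 5 * y / 120 + V 4 2 * x ^ 4 * y ^ 2 / 48
    + V 3 3 * x ^ 3 * y ^ 3 / 36 + V 2 4 * x ^ 2 * y ^ 4 / 48 + V 1 5 * x * y ^ 5 / 120
    + V 0 6 * y ^ 6 / 720
    + V 7 0 * x ^ 7 / 5040 + V 6 1 * x ^ 6 * y / 720 + V 5 2 * x ^ 5 * y ^ 2 / 240
    + V 4 3 * x ^ 4 * y ^ 3 / 144 + V 3 4 * x ^ 3 * y ^ 4 / 144 + V 2 5 * x ^ 2 * y ^ 5 / 240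
    + V 1 6 * x * y ^ 6 / 720 + V 0 7 * y ^ 7 / 5040 := by
  simp [taylorPoly, sum_Lam, Finset.sum_range_succ, Nat.factorial]
  ring

theorem isBigO_sum_schrodingerCoeff {q V : ℕ → ℕ → ℝ}
    (hV : ∀ i j, i + j ≤ 5 → V (i + 2) j + V i (j + 2) = leib q V i j) :
    (fun h => ∑ k ∈ stIdx, ∑ l ∈ stIdx, schrodingerCoeff q k l h * taylorPoly 7 V (k * h) (l * h))
      =O[𝓝 0] fun h => h ^ 8 := by
  -- The remainders are the higher Taylor terms of the central differences; for a polynomial of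
  -- degree 7 they are exact.
  have key := fun h : ℝ => schrodingerForm_eq hV h
    (V 5 0 / 120 + h ^ 2 * V 7 0 / 5040) (V 0 5 / 120 + h ^ 2 * V 0 7 / 5040)
    (V 4 0 / 12 + h ^ 2 * V 6 0 / 360) (V 0 4 / 12 + h ^ 2 * V 0 6 / 360)
    ((V 3 1 + V 1 3) / 6 + h ^ 2 * (V 5 1 / 120 + V 3 3 / 36 + V 1 5 / 120))
    (V 3 2 / 6 + V 1 4 / 12 + h ^ 2 * (V 5 2 / 120 + V 3 4 / 72 + V 1 6 / 360))
    (V 2 3 / 6 + V 4 1 / 12 + h ^ 2 * (V 2 5 / 120 + V 4 3 / 72 + V 6 1 / 360))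
    ((V 4 2 + V 2 4) / 12)
  have e : ∀ h : ℝ, ∑ k ∈ stIdx, ∑ l ∈ stIdx,
      schrodingerCoeff q k l h * taylorPoly 7 V (k * h) (l * h) = _ := fun h => by
    refine Eq.trans ?_ (key h)
    rw [sum_schrodingerCoeff q h fun k l => taylorPoly 7 V (k * h) (l * h)]
    simp only [taylorPoly_seven]
    push_cast
    congr 1 <;> ring
  simp only [e]
  refine ((Asymptotics.isBigO_refl _ _).mul (Asymptotics.IsBigO.congr_left
    (Continuous.tendsto ?_ 0 |>.isBigO_one ℝ) fun _ => rfl)).trans_eventuallyEq ?_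
  · fun_prop
  · simp

/-! ### Existence of a scheme -/

/-- The substitution `v = wu` turns `∇·(w²∇u)` into `w(Δv - (Δw/w)v)`. -/
theorem laplacian_mul_eventuallyEq {w u : ℝ × ℝ → ℝ} {p : ℝ × ℝ}
    (hw : ContDiffAt ℝ (2 : ℕ) w p) (hu : ContDiffAt ℝ (2 : ℕ) u p) (hp : w p ≠ 0) :
    (fun q => pderiv 2 0 (fun z => w z * u z) q + pderiv 0 2 (fun z => w z * u z) q)
      =ᶠ[𝓝 p] fun q => (pderiv 2 0 w q + pderiv 0 2 w q) / w q * (w q * u q)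
        + -1 / w q * ellip (fun z => w z * w z) u q := by
  have hww : ContDiffAt ℝ (1 : ℕ) (fun z => w z * w z) p :=
    (hw.of_nat_le one_le_two).mul (hw.of_nat_le one_le_two)
  filter_upwards [hw.eventually (by simp), hu.eventually (by simp),
    hw.continuousAt.eventually_ne hp, ellip_eventuallyEq hww hu] with q hwq huq hq0 he
  have hwd : DifferentiableAt ℝ w q := hwq.differentiableAt (by simp)
  rw [he, dx_mul hwd hwd, dy_mul hwd hwd, pderiv_mul 2 0 hwq huq, pderiv_mul 0 2 hwq huq]
  simp [leib, Finset.sum_range_succ, jetAt, pderiv]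
  field_simp
  ring

theorem leib_zero_right (A : ℕ → ℕ → ℝ) (m n : ℕ) : leib A (fun _ _ => 0) m n = 0 := by
  simp [leib]

theorem jetAt_laplacian {v : ℝ × ℝ → ℝ} {p : ℝ × ℝ} {m n : ℕ}
    (hv : ContDiffAt ℝ (m + n + 2 : ℕ) v p) :
    pderiv m n (fun q => pderiv 2 0 v q + pderiv 0 2 v q) p
      = jetAt v p (m + 2) n + jetAt v p m (n + 2) := by
  have hx := contDiffAt_dx hv
  have hy := contDiffAt_dy hv
  rw [pderiv_add m n (f := pderiv 2 0 v) (g := pderiv 0 2 v)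
    (contDiffAt_dx hx) (contDiffAt_dy hy)]
  refine congrArg₂ _ ?_ rfl
  refine (jetAt_dx (g := dx v) m (hx.of_nat_le (by omega))).trans ?_
  exact jetAt_dx (m + 1) (hv.of_nat_le (by omega))

/-- Multiplying a scheme for `Δv = qv` by `w` gives a scheme for `∇·(w²∇u) = 0`. -/
theorem isBigO_sum_schrodingerCoeff_mul {w u : ℝ × ℝ → ℝ} {p : ℝ × ℝ}
    (hw : ContDiffAt ℝ (8 : ℕ) w p) (hu : ContDiffAt ℝ (8 : ℕ) u p) (hp : w p ≠ 0)
    (he : ∀ m n, m + n ≤ 5 → pderiv m n (ellip (fun z => w z * w z) u) p = 0) :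
    (fun h : ℝ => ∑ k ∈ stIdx, ∑ l ∈ stIdx,
      schrodingerCoeff (jetAt (fun q => (pderiv 2 0 w q + pderiv 0 2 w q) / w q) p) k l h
        * (w (p.1 + k * h, p.2 + l * h) * u (p.1 + k * h, p.2 + l * h)))
      =O[𝓝 0] fun h => h ^ 8 := by
  set Q : ℝ × ℝ → ℝ := fun q => (pderiv 2 0 w q + pderiv 0 2 w q) / w q with hQdef
  set v : ℝ × ℝ → ℝ := fun q => w q * u q with hvdef
  have hv : ContDiffAt ℝ (8 : ℕ) v p := hw.mul hu
  have hQ : ContDiffAt ℝ (6 : ℕ) Q p :=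
    ((contDiffAt_pderiv 2 0 (n := 6) hw).add (contDiffAt_pderiv 0 2 (n := 6) hw)).div
      (hw.of_nat_le (by norm_num)) hp
  -- The source term `-1/w · ellip` has zero jet through order 5, so by the Leibniz rule only `qv`
  -- remains.
  have hrel : ∀ i j, i + j ≤ 5 → jetAt v p (i + 2) j + jetAt v p i (j + 2)
      = leib (jetAt Q p) (jetAt v p) i j := by
    intro i j hij
    have hww : ContDiffAt ℝ (7 : ℕ) (fun z => w z * w z) p :=
      (hw.of_nat_le (by norm_num)).mul (hw.of_nat_le (by norm_num))
    have hE : ContDiffAt ℝ (6 : ℕ) (ellip (fun z => w z * w z) u) p := by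
      have h1 : ContDiffAt ℝ (7 : ℕ) (fun z => w z * w z * dx u z) p :=
        hww.mul (contDiffAt_dx hu)
      have h2 : ContDiffAt ℝ (7 : ℕ) (fun z => w z * w z * dy u z) p :=
        hww.mul (contDiffAt_dy hu)
      exact ((contDiffAt_dx h1).add (contDiffAt_dy h2)).neg
    have hw' : ContDiffAt ℝ (6 : ℕ) (fun q => -1 / w q) p :=
      contDiffAt_const.div (hw.of_nat_le (by norm_num)) hp
    have hv6 : ContDiffAt ℝ (6 : ℕ) v p := hv.of_nat_le (by norm_num)
    rw [← jetAt_laplacian (hv.of_nat_le (by omega)),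
      (pderiv_congr i j (laplacian_mul_eventuallyEq (hw.of_nat_le (by norm_num))
        (hu.of_nat_le (by norm_num)) hp)).eq_of_nhds,
      pderiv_add i j (((hQ.mul hv6).of_nat_le (by omega)))
        ((hw'.mul hE).of_nat_le (by omega)),
      pderiv_mul i j (hQ.of_nat_le (by omega)) (hv6.of_nat_le (by omega)),
      pderiv_mul i j (hw'.of_nat_le (by omega)) (hE.of_nat_le (by omega)),
      leib_congr (B := jetAt (ellip _ u) p) (B' := fun _ _ => 0) (fun _ _ _ => rfl)
        (fun m n hmn => he m n (by omega)), leib_zero_right, add_zero]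
  have e : ∀ h : ℝ, ∑ k ∈ stIdx, ∑ l ∈ stIdx,
      schrodingerCoeff (jetAt Q p) k l h * v (p.1 + k * h, p.2 + l * h)
      = ∑ k ∈ stIdx, ∑ l ∈ stIdx, schrodingerCoeff (jetAt Q p) k l h
          * (v (p.1 + k * h, p.2 + l * h) - taylorPoly 7 (jetAt v p) (k * h) (l * h))
        + ∑ k ∈ stIdx, ∑ l ∈ stIdx,
          schrodingerCoeff (jetAt Q p) k l h * taylorPoly 7 (jetAt v p) (k * h) (l * h) := by
    intro h
    simp only [← Finset.sum_add_distrib, ← mul_add, sub_add_cancel]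
  refine Asymptotics.IsBigO.congr_left ?_ fun h => (e h).symm
  refine Asymptotics.IsBigO.add ?_ (isBigO_sum_schrodingerCoeff hrel)
  refine Asymptotics.IsBigO.fun_sum fun k _ => Asymptotics.IsBigO.fun_sum fun l _ => ?_
  have hc : Continuous (schrodingerCoeff (jetAt Q p) k l) := by
    unfold schrodingerCoeff schrodingerForm
    fun_prop
  simpa using ((hc.tendsto 0).isBigO_one ℝ).mul (taylor_ray_of_contDiffAt 7 hv k l)

/-- A smooth function of `h` agrees with a polynomial of degree seven up to `O(h⁸)`. -/
theorem exists_polyCoeff_approx {D : ℤ → ℤ → ℝ → ℝ} (hD : ∀ k l, ContDiffAt ℝ (8 : ℕ) (D k l) 0) :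
    ∃ c : ℤ → ℤ → ℕ → ℝ, (∀ k l, c k l 0 = D k l 0) ∧ ∀ k l,
      (fun h => polyCoeff 6 c k l h - D k l h) =O[𝓝 0] fun h => h ^ 8 := by
  -- Regarding `D` as constant in a second variable reduces the claim to the planar expansion along
  -- the ray `(1, 0)`.
  let g : ℤ → ℤ → ℝ × ℝ → ℝ := fun k l q => D k l q.1
  have hg : ∀ k l, ContDiffAt ℝ (8 : ℕ) (g k l) 0 := fun k l =>
    ContDiffAt.comp (g := D k l) (f := Prod.fst) (0 : ℝ × ℝ) (hD k l) contDiffAt_fst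
  refine ⟨fun k l i => jetAt (g k l) 0 i 0 / i.factorial, fun k l => ?_, fun k l => ?_⟩
  · simp [jetAt, pderiv, g]
  · refine ((taylor_ray_of_contDiffAt 7 (hg k l) 1 0).neg_left).congr_left fun h => ?_
    rw [taylorPoly_seven]
    simp [polyCoeff, Finset.sum_range_succ, g, Nat.factorial]
    ring

/-- Since the `G_{m,n}` depend only on the array `α`, the scheme may be built for any coefficient
with this jet; positivity of `α 0 0` provides the square root. -/
theorem exists_nontriv_solvesSystem {α : ℕ → ℕ → ℝ} (hα : 0 < α 0 0) :
    ∃ c, Nontriv c ∧ SolvesSystem α 6 c := by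
  -- Order 6 of the coefficient is all that the equation differentiated up to order 5 sees. The
  -- polynomial is smooth, so `q = Δw/w` has the derivatives used in the scheme, which a coefficient
  -- of class `C⁶` would not guarantee.
  set b : ℝ × ℝ → ℝ := polyAt 6 α 0 with hb
  have hb0 : b 0 = α 0 0 := jetAt_polyAt (K := 6) (m := 0) (n := 0) (by norm_num) α 0
  set w : ℝ × ℝ → ℝ := fun q => √(b q) with hwdef
  have hbs : ∀ n : ℕ, ContDiffAt ℝ n b 0 := fun n => (contDiff_polyAt 6 α 0).contDiffAt
  have hw : ∀ n : ℕ, ContDiffAt ℝ n w 0 := fun n => (hbs n).sqrt (by rw [hb0]; exact hα.ne')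
  have hw0 : w 0 ≠ 0 := by
    simp only [hwdef, hb0]
    exact (Real.sqrt_pos.2 hα).ne'
  have hww : (fun z => w z * w z) =ᶠ[𝓝 0] b := by
    filter_upwards [(hbs 0).continuousAt.eventually (lt_mem_nhds (hb0 ▸ hα))] with q hq
    exact Real.mul_self_sqrt hq.le
  set q := jetAt (fun q => (pderiv 2 0 w q + pderiv 0 2 w q) / w q) 0 with hqdef
  have hcs : ∀ (k l : ℤ) (n : ℕ), ContDiff ℝ n (schrodingerCoeff q k l) := by
    intro k l n
    unfold schrodingerCoeff schrodingerForm
    fun_prop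
  have hray : ∀ k l : ℤ, ContDiffAt ℝ (8 : ℕ) (fun h : ℝ => w (k * h, l * h)) 0 := by
    intro k l
    have h1 : ContDiffAt ℝ (8 : ℕ) w ((k : ℝ) * 0, (l : ℝ) * 0) := by
      rw [mul_zero, mul_zero]
      exact hw 8
    exact ContDiffAt.comp (g := w) (f := fun h : ℝ => ((k : ℝ) * h, (l : ℝ) * h)) 0 h1
      (by fun_prop)
  obtain ⟨c, hc0, hc⟩ := exists_polyCoeff_approx
    (D := fun k l h => schrodingerCoeff q k l h * w (k * h, l * h))
    fun k l => (hcs k l 8).contDiffAt.mul (hray k l)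
  refine ⟨c, ⟨0, by decide, 0, by decide, ?_⟩, ?_⟩
  · rw [hc0]
    -- The centre weight of the nine-point Laplacian, which makes the solution nontrivial.
    have h1 : schrodingerCoeff q 0 0 0 = -20 := by
      simp [schrodingerCoeff, schrodingerForm]
    have h2 : ((0 : ℝ), (0 : ℝ)) = 0 := rfl
    simpa [h1, h2] using hw0
  · rintro ⟨m, n⟩ hμ
    obtain ⟨hmn, hm⟩ := mem_LamV1.1 hμ
    set J := solJet α (unitJet m n) 0 with hJ
    have hu : ∀ k : ℕ, ContDiffAt ℝ k (polyAt 7 J 0) 0 := fun k =>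
      (contDiff_polyAt 7 J 0).contDiffAt
    have he : ∀ i j, i + j ≤ 5 →
        pderiv i j (ellip (fun z => w z * w z) (polyAt 7 J 0)) 0 = 0 := by
      intro i j hij
      rw [(pderiv_congr i j (ellip_congr hww EventuallyEq.rfl)).eq_of_nhds,
        pderiv_ellip i j (hbs _) (hu _), divGradJet_congr (β := α) (V := J)
          (fun i' j' h' => jetAt_polyAt (by omega) _ _)
          (fun i' j' h' => jetAt_polyAt (by omega) _ _), hJ, divGradJet_solJet hα.ne']
      simp
    have h1 := isBigO_sum_schrodingerCoeff_mul (hw 8) (hu 8) hw0 he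
    have e : ∀ h : ℝ, ∑ k ∈ stIdx, ∑ l ∈ stIdx,
        polyCoeff 6 c k l h * GV α 6 m n (k * h) (l * h)
        = ∑ k ∈ stIdx, ∑ l ∈ stIdx,
          (polyCoeff 6 c k l h - schrodingerCoeff q k l h * w (k * h, l * h))
            * taylorPoly 7 J (k * h) (l * h)
          + ∑ k ∈ stIdx, ∑ l ∈ stIdx, schrodingerCoeff q k l h
            * (w ((0 : ℝ × ℝ).1 + k * h, (0 : ℝ × ℝ).2 + l * h)
              * polyAt 7 J 0 ((0 : ℝ × ℝ).1 + k * h, (0 : ℝ × ℝ).2 + l * h)) := by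
      intro h
      simp only [← Finset.sum_add_distrib]
      refine Finset.sum_congr rfl fun k _ => Finset.sum_congr rfl fun l _ => ?_
      rw [GV_eq_taylorPoly hα.ne' hm hmn]
      simp only [polyAt, Prod.fst_zero, Prod.snd_zero, zero_add, sub_zero]
      ring
    refine Asymptotics.IsBigO.mono (Asymptotics.IsBigO.congr_left ?_ fun h => (e h).symm)
      nhdsWithin_le_nhds
    refine Asymptotics.IsBigO.add ?_ h1
    refine Asymptotics.IsBigO.fun_sum fun k _ => Asymptotics.IsBigO.fun_sum fun l _ => ?_
    have ht : Continuous fun h : ℝ => taylorPoly 7 J (k * h) (l * h) := by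
      unfold taylorPoly
      fun_prop
    simpa using (hc k l).mul ((ht.tendsto 0).isBigO_one ℝ)

end CompactFD

/-! ### Assembly of the claims at a point off the interface. -/

theorem theorem2p1 (l₁ l₂ l₃ l₄ : ℝ) (ψ a : ℝ × ℝ → ℝ)
    (hψ : ContinuousOn ψ (rect l₁ l₂ l₃ l₄))
    (ha : IsCoefficient (rect l₁ l₂ l₃ l₄) ψ a)
    (p : ℝ × ℝ) (hp : p ∈ rect l₁ l₂ l₃ l₄ \ interface (rect l₁ l₂ l₃ l₄) ψ) :
    -- for all small `h` the stencil centred at `p` lies in `Ω` and `p` is a regular point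
    (∀ᶠ h in 𝓝[>] (0 : ℝ), IsRegularPoint ψ p h ∧
      ∀ k ∈ stIdx, ∀ l ∈ stIdx, stPt p h k l ∈ rect l₁ l₂ l₃ l₄) ∧
    -- the order-matching system with `M = 6` has a nontrivial solution
    (∃ c, Nontriv c ∧ SolvesSystem (jetAt a p) 6 c) ∧
    -- every nontrivial solution gives a sixth-order consistent scheme
    (∀ c, Nontriv c → SolvesSystem (jetAt a p) 6 c →
      ∃ lam : ℝ, lam ≠ 0 ∧ ∀ u f : ℝ × ℝ → ℝ, IsSolution (rect l₁ l₂ l₃ l₄) ψ a u f →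
        Tendsto (fun h : ℝ => stencilOp (polyCoeff 6 c) p u h / h ^ 2) (𝓝[>] 0)
          (𝓝 (lam * f p)) ∧
        truncError 5 (polyCoeff 6 c) (rhsCoeff (jetAt a p) 6 c) p u f
          =O[𝓝[>] 0] fun h : ℝ => h ^ 8) ∧
    -- six is the maximum accuracy order of a compact nine-point scheme at `p`
    IsGreatest {q : ℕ | ∃ (N : ℕ) (C : ℤ → ℤ → ℝ → ℝ) (F : ℕ → ℕ → ℝ → ℝ),
      ContDiffAt ℝ ((N + 1 : ℕ) : WithTop ℕ∞) a p ∧ HasAccuracyOrder a p N C F q} 6 := by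
  have hΩ := isOpen_rect l₁ l₂ l₃ l₄
  have hnhds := mem_nhds_omega hΩ hψ hp
  obtain ⟨ha6, ha0⟩ := ha.local hnhds
  refine ⟨?_, exists_nontriv_solvesSystem (α := jetAt a p) ha0, ?_, ?_, ?_⟩
  · exact (eventually_isRegularPoint hnhds).and (eventually_stPt_mem (hΩ.mem_nhds hp.1))
  · intro c hnt hc
    refine ⟨leadRhs (jetAt a p) c,
      leadRhs_ne_zero (α := jetAt a p) ha0.ne' (by norm_num) hc hnt, fun u f hu => ?_⟩
    obtain ⟨hu7, hlip, hf⟩ := hu.local hnhds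
    have ht := isBigO_truncError (M := 5) ha6 ha0.ne' hu7 hlip hf hc
    exact ⟨tendsto_stencilOp_div (α := jetAt a p) ha0.ne' ht, ht⟩
  · obtain ⟨c, hnt, hc⟩ := exists_nontriv_solvesSystem (α := jetAt a p) ha0
    exact ⟨5, polyCoeff 6 c, rhsCoeff (jetAt a p) 6 c, ha6,
      hasAccuracyOrder_six ha6 ha0.ne' hnt hc⟩
  · rintro q ⟨N, C, F, haN, h⟩
    exact order_le_six ha0.ne' haN h
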